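/- **Theorem 5.1.** Let $F$ be a non-archimedean local field of characteristic zero, $\psi:F\to\mathbb C^{1}$ a nontrivial continuous additive character, and $m,n\ge 0$ integers with $2m\ge n$. Let $v_k$ be the $k\times k$ matrix with $1$'s on the second diagonal and $0$'s elsewhere, $J_{2\ell}=\begin{pmatrix}0&v_\ell\\-v_\ell&0\end{pmatrix}$, and $$SO_{2\ell}=\{g\in GL_{2\ell}(F): {}^tg\,v_{2\ell}\,g=v_{2\ell},\ \det g=1\},\qquad Sp_{2\ell}=\{g\in GL_{2\ell}(F): {}^tg\,J_{2\ell}\,g=J_{2\ell}\}$$ (trivial groups for $\ell=0$). Let $V=F^{2p}$ be the quadratic space with form $v_{2p}$ and basis $e_1,\dots,e_p,e_{-p},\dots,e_{-1}$, with $V^{+}=\langle e_i\rangle$, $V^-=\langle e_{-i}\rangle$, and $W=F^{2q}$ the symplectic space with form $J_{2q}$ and basis $f_1,\dots,f_q,f_{-q},\dots,f_{-1}$, with $W^{\pm}$ defined likewise. Let $\mathcal S(X)$ be the space of locally constant compactly supported functions $X\to\mathbb C$. The Weil representation $\omega_\psi$ of $SO(V)\times Sp(W)$ is realized on $\mathcal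 S(V\otimes W^+)\cong\mathcal S(V^-\otimes W)$, the isomorphism being the partial Fourier transform $$\widehat\varphi(a,b)=\int_{V^+\otimes W^+}\varphi(x,a)\,\psi(\langle x,b\rangle)\,dx,\qquad a\in V^-\otimes W^+,\ b\in V^-\otimes W^-,$$ where $\langle e_i\otimes f_j,\,e_{-k}\otimes f_{-l}\rangle=\delta_{ik}\delta_{jl}$; $SO(V)$ acts on $\mathcal S(V\otimes W^+)$ by $\varphi\mapsto\varphi\circ h^{-1}$, and $Sp(W)$ acts on $\mathcal S(V^-\otimes W)$ by $\varphi\mapsto\varphi(\,\cdot\, g)$ ($W$ being viewed as a space of row vectors). For $a+b=N$ let $Sp_{2a}\times Sp_{2b}\subseteq Sp_{2N}$ and $SO_{2a}\times SO_{2b}\subseteq SO_{2N}$ be embedded by $$\left(\begin{pmatrix}A_1&B_1\\C_1&D_1\end{pmatrix},\begin{pmatrix}A_2&B_2\\C_2&D_2\end{pmatrix}\right)\mapsto\begin{pmatrix}A_1&0&0&B_1\\0&A_2&B_2&0\\0&C_2&D_2&0\\C_1&0&0&D_1\end{pmatrix}.$$ An irreducible admissible (complex) representation $\pi$ of $Sp_{4m}$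 has a nonzero generalized symplectic linear model if $\mathrm{Hom}_{Sp_{2n}\times Sp_{4m-2n}}(\pi,1)\ne0$; an irreducible admissible representation $\sigma$ of $SO_{4m}$ has a nonzero generalized orthogonal linear model if $\mathrm{Hom}_{SO_{2n}\times SO_{4m-2n}}(\sigma,1)\neq0$. Let $\Theta(1_{W},V)$ be the maximal quotient of $\mathcal S(V^-\otimes W)$ on which $Sp(W)$ acts trivially, a representation of $SO(V)$, and $\Theta(1_V,W)$ the maximal quotient of $\mathcal S(V\otimes W^+)$ on which $SO(V)$ acts trivially, a representation of $Sp(W)$. 1. Let $\pi$ be an irreducible admissible representation of $Sp_{4m}$ with a nonzero generalized symplectic linear model, and $\sigma$ an irreducible admissible representation of $SO_{4n}$ with $\mathrm{Hom}_{SO_{4n}\times Sp_{4m}}(\omega_\psi,\sigma\otimes\pi)\ne0$. Then $$\mathrm{Hom}_{SO_{4n}}\big(\Theta(1_{W_1},V)\otimes\Theta(1_{W_2},V),\,\sigma\big)\neq0,$$ where $\dim V=4n$, and $W_1$, $W_2$ are the symplectic spaces above of dimensions $2n$ and $4m-2n$. 2. Let $\sigma$ be an irreducible admissible representation of $SO_{4m}$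 with a nonzero generalized orthogonal linear model, and $\pi$ an irreducible admissible representation of $Sp_{4n}$ with $\mathrm{Hom}_{SO_{4m}\times Sp_{4n}}(\omega_\psi,\sigma\otimes\pi)\ne0$. Then $$\mathrm{Hom}_{Sp_{4n}}\big(\Theta(1_{V_1},W)\otimes\Theta(1_{V_2},W),\,\pi\big)\neq0,$$ where $\dim W=4n$, and $V_1$, $V_2$ are the split quadratic spaces above of dimensions $2n$ and $4m-2n$. -/

import Mathlib

open scoped Matrix TensorProduct
open ValuativeRel MeasureTheory
namespace LocalTheta

set_option linter.unusedSectionVars false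

noncomputable section

/-- The Schwartz--Bruhat space `𝒮(X)`: locally constant, compactly supported complex functions. -/
def schwartzBruhat (X : Type*) [TopologicalSpace X] : Submodule ℂ (X → ℂ) where
  carrier := {f | IsLocallyConstant f ∧ HasCompactSupport f}
  add_mem' hf hg := ⟨hf.1.add hg.1, hf.2.add hg.2⟩
  zero_mem' := ⟨IsLocallyConstant.const 0, HasCompactSupport.zero⟩
  smul_mem' c _ hf := ⟨hf.1.comp (fun z => c * z), hf.2.comp_left (mul_zero c)⟩

/-- Composition with a homeomorphism. -/
def schwartzComp {X Y : Type*} [TopologicalSpace X] [TopologicalSpace Y] (e : X ≃ₜ Y) :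
    schwartzBruhat Y ≃ₗ[ℂ] schwartzBruhat X where
  toFun f := ⟨fun x => f.1 (e x), f.2.1.comp_continuous e.continuous,
    f.2.2.comp_homeomorph e⟩
  invFun f := ⟨fun y => f.1 (e.symm y), f.2.1.comp_continuous e.symm.continuous,
    f.2.2.comp_homeomorph e.symm⟩
  map_add' _ _ := rfl
  map_smul' _ _ := rfl
  left_inv f := by ext y; simp
  right_inv f := by ext x; simp

/-- Integration against a Haar measure of a locally compact abelian group. -/
def haarIntegral {E : Type*} [AddCommGroup E] [TopologicalSpace E] [IsTopologicalAddGroup E]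
    [LocallyCompactSpace E] (f : E → ℂ) : ℂ :=
  letI : MeasurableSpace E := borel E
  haveI : BorelSpace E := ⟨rfl⟩
  ∫ x, f x ∂(Measure.addHaar : Measure E)

section Haar
variable {E : Type*} [AddCommGroup E] [TopologicalSpace E] [IsTopologicalAddGroup E]
    [LocallyCompactSpace E]

theorem haarIntegral_translate (f : E → ℂ) (u : E) :
    haarIntegral (fun x => f (x + u)) = haarIntegral f := by
  let _ : MeasurableSpace E := borel E
  have _ : BorelSpace E := ⟨rfl⟩
  exact integral_add_right_eq_self f u

theorem haarIntegral_const_mul (c : ℂ) (f : E → ℂ) :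
    haarIntegral (fun x => c * f x) = c * haarIntegral f := by
  let _ : MeasurableSpace E := borel E
  have _ : BorelSpace E := ⟨rfl⟩
  exact integral_const_mul c f

theorem haarIntegral_add {f g : E → ℂ} (hf : Continuous f) (hf' : HasCompactSupport f)
    (hg : Continuous g) (hg' : HasCompactSupport g) :
    haarIntegral (fun x => f x + g x) = haarIntegral f + haarIntegral g := by
  let _ : MeasurableSpace E := borel E
  have _ : BorelSpace E := ⟨rfl⟩
  exact integral_add (hf.integrable_of_hasCompactSupport hf')
    (hg.integrable_of_hasCompactSupport hg')

theorem haarIntegral_swap {f : E → E → ℂ} (hf : Continuous f.uncurry)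
    (hf' : HasCompactSupport f.uncurry) :
    haarIntegral (fun x => haarIntegral (fun y => f x y)) =
      haarIntegral (fun y => haarIntegral (fun x => f x y)) := by
  let _ : MeasurableSpace E := borel E
  have _ : BorelSpace E := ⟨rfl⟩
  exact integral_integral_swap_of_hasCompactSupport hf hf'

theorem haarIntegral_subgroup_ne_zero (L : AddSubgroup E) (ho : IsOpen (L : Set E))
    (hc : IsCompact (L : Set E)) :
    haarIntegral ((L : Set E).indicator (fun _ => (1 : ℂ))) ≠ 0 := by
  let _ : MeasurableSpace E := borel E
  have _ : BorelSpace E := ⟨rfl⟩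
  have h : haarIntegral ((L : Set E).indicator (fun _ => (1 : ℂ))) =
      ((Measure.addHaar : Measure E).real (L : Set E) : ℂ) := by
    change ∫ x, (L : Set E).indicator (fun _ => (1 : ℂ)) x ∂_ = _
    rw [integral_indicator ho.measurableSet]
    simp
  rw [h, Ne, Complex.ofReal_eq_zero, Measure.real, ENNReal.toReal_eq_zero_iff, not_or]
  exact ⟨(ho.measure_pos _ ⟨0, L.zero_mem⟩).ne', hc.measure_lt_top.ne⟩

end Haar

section Lattices
variable {F : Type*} [Field F] [ValuativeRel F] [TopologicalSpace F]
  [IsNonarchimedeanLocalField F] {ι κ : Type*} [Fintype ι] [Fintype κ]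

instance : LocallyCompactSpace (Matrix ι κ F) :=
  inferInstanceAs (LocallyCompactSpace (ι → κ → F))

variable (ι κ) in
/-- The lattice of matrices all of whose entries have valuation at most that of `c`. -/
def ball (c : F) : AddSubgroup (Matrix ι κ F) where
  carrier := {x | ∀ i j, valuation F (x i j) ≤ valuation F c}
  zero_mem' i j := by simp
  add_mem' hx hy i j := (Valuation.map_add _ _ _).trans (max_le (hx i j) (hy i j))
  neg_mem' hx i j := by simpa using hx i j

theorem mem_ball {c : F} {x : Matrix ι κ F} :
    x ∈ ball ι κ c ↔ ∀ i j, valuation F (x i j) ≤ valuation F c := Iff.rfl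

theorem ball_mono {c d : F} (h : valuation F c ≤ valuation F d) : ball ι κ c ≤ ball ι κ d :=
  fun _ hx i j => (hx i j).trans h

theorem isOpen_closedBall {c : F} (hc : c ≠ 0) :
    IsOpen {x : F | valuation F x ≤ valuation F c} := by
  let L : AddSubgroup F :=
    { carrier := {x : F | valuation F x ≤ valuation F c}
      zero_mem' := by simp
      add_mem' := fun {x y} hx hy => by
        change valuation F (x + y) ≤ valuation F c
        exact (Valuation.map_add _ x y).trans (max_le hx hy)
      neg_mem' := fun {x} hx => by simpa using hx }
  refine AddSubgroup.isOpen_of_mem_nhds L (g := 0) ?_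
  refine (IsValuativeTopology.hasBasis_nhds_zero' F).mem_iff.2 ⟨valuation F c, by simpa, ?_⟩
  intro x hx
  have hx' : valuation F x < valuation F c := hx
  exact hx'.le

theorem ball_eq_pi (c : F) : (ball ι κ c : Set (Matrix ι κ F)) =
    Set.univ.pi (fun _ => Set.univ.pi (fun _ => {x : F | valuation F x ≤ valuation F c})) := by
  ext x
  exact ⟨fun h i _ j _ => h i j, fun h i j => h i trivial j trivial⟩

theorem isOpen_ball {c : F} (hc : c ≠ 0) : IsOpen (ball ι κ c : Set (Matrix ι κ F)) := by
  rw [ball_eq_pi]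
  exact isOpen_set_pi Set.finite_univ fun _ _ =>
    isOpen_set_pi Set.finite_univ fun _ _ => isOpen_closedBall hc

theorem isCompact_ball (c : F) : IsCompact (ball ι κ c : Set (Matrix ι κ F)) := by
  rw [ball_eq_pi]
  exact isCompact_univ_pi fun _ => isCompact_univ_pi fun _ =>
    IsNonarchimedeanLocalField.isCompact_closedBall F _

theorem isClosed_ball {c : F} (hc : c ≠ 0) : IsClosed (ball ι κ c : Set (Matrix ι κ F)) :=
  AddSubgroup.isClosed_of_isOpen _ (isOpen_ball hc)

theorem exists_min (c d : F) (hc : c ≠ 0) (hd : d ≠ 0) :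
    ∃ e : F, e ≠ 0 ∧ valuation F e ≤ valuation F c ∧ valuation F e ≤ valuation F d := by
  rcases le_total (valuation F c) (valuation F d) with h | h
  · exact ⟨c, hc, le_rfl, h⟩
  · exact ⟨d, hd, h, le_rfl⟩

theorem exists_max (c d : F) (hc : c ≠ 0) :
    ∃ e : F, e ≠ 0 ∧ valuation F c ≤ valuation F e ∧ valuation F d ≤ valuation F e := by
  rcases le_total (valuation F c) (valuation F d) with h | h
  · refine ⟨d, ?_, h, le_rfl⟩
    rintro rfl
    simp [hc] at h
  · exact ⟨c, hc, le_rfl, h⟩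

theorem exists_min_fintype {α : Type*} [Fintype α] (c : α → F) (hc : ∀ i, c i ≠ 0) :
    ∃ e : F, e ≠ 0 ∧ ∀ i, valuation F e ≤ valuation F (c i) := by
  classical
  suffices h : ∀ s : Finset α, ∃ e : F, e ≠ 0 ∧ ∀ i ∈ s, valuation F e ≤ valuation F (c i) by
    obtain ⟨e, he, h⟩ := h Finset.univ
    exact ⟨e, he, fun i => h i (Finset.mem_univ i)⟩
  intro s
  induction s using Finset.induction_on with
  | empty => exact ⟨1, one_ne_zero, by simp⟩
  | insert a s _ ih =>
    obtain ⟨e, he, h⟩ := ih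
    obtain ⟨e', he', h1, h2⟩ := exists_min e (c a) he (hc a)
    refine ⟨e', he', fun i hi => ?_⟩
    rcases Finset.mem_insert.1 hi with rfl | hi
    · exact h2
    · exact h1.trans (h i hi)

theorem exists_ball_subset_aux {U : Set (ι → κ → F)} (hU : U ∈ nhds 0) :
    ∃ c : F, c ≠ 0 ∧ ∀ x : ι → κ → F, (∀ i j, valuation F (x i j) ≤ valuation F c) → x ∈ U := by
  have key : ∀ V ∈ nhds (0 : F), ∃ c : F, c ≠ 0 ∧ {x | valuation F x ≤ valuation F c} ⊆ V := by
    intro V hV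
    obtain ⟨r, hr, hrV⟩ := (IsValuativeTopology.hasBasis_nhds_zero' F).mem_iff.1 hV
    obtain ⟨a, rfl⟩ := ValuativeRel.valuation_surjective r
    have ha : a ≠ 0 := by rintro rfl; simp at hr
    obtain ⟨t, ht0, ht1⟩ := Valuation.IsNontrivial.exists_lt_one (v := valuation F)
    have ht0' : t ≠ 0 := by rintro rfl; simp at ht0
    refine ⟨a * t, mul_ne_zero ha ht0', fun x hx => hrV ?_⟩
    change valuation F x < valuation F a
    have hx' : valuation F x ≤ valuation F (a * t) := hx
    refine lt_of_le_of_lt hx' ?_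
    rw [map_mul]
    exact mul_lt_of_lt_one_right (zero_lt_iff.2 hr) ht1
  rw [nhds_pi, Filter.mem_pi'] at hU
  obtain ⟨I, t, ht, htU⟩ := hU
  have h2 : ∀ i, ∃ c : F, c ≠ 0 ∧
      ∀ y : κ → F, (∀ j, valuation F (y j) ≤ valuation F c) → y ∈ t i := by
    intro i
    have h3 := ht i
    rw [nhds_pi, Filter.mem_pi'] at h3
    obtain ⟨J, s, hs, hst⟩ := h3
    choose d hd hds using fun j => key (s j) (hs j)
    obtain ⟨e, he, hed⟩ := exists_min_fintype d hd
    exact ⟨e, he, fun y hy => hst fun j _ => hds j ((hy j).trans (hed j))⟩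
  choose d hd hds using h2
  obtain ⟨e, he, hed⟩ := exists_min_fintype d hd
  exact ⟨e, he, fun x hx => htU fun i _ => hds i _ fun j => (hx i j).trans (hed i)⟩

theorem exists_ball_subset {U : Set (Matrix ι κ F)} (hU : U ∈ nhds 0) :
    ∃ c : F, c ≠ 0 ∧ (ball ι κ c : Set (Matrix ι κ F)) ⊆ U :=
  exists_ball_subset_aux (ι := ι) (κ := κ) hU

theorem exists_subset_ball {K : Set (Matrix ι κ F)} (hK : IsCompact K) :
    ∃ c : F, c ≠ 0 ∧ K ⊆ ball ι κ c := by
  have h := hK.induction_on (p := fun s => ∃ c : F, c ≠ 0 ∧ s ⊆ ball ι κ c)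
    ⟨1, one_ne_zero, Set.empty_subset _⟩
    (fun s t hst ⟨c, hc, h⟩ => ⟨c, hc, hst.trans h⟩)
    (fun s t ⟨c, hc, h⟩ ⟨d, hd, h'⟩ => by
      obtain ⟨e, he, h1, h2⟩ := exists_max c d hc
      exact ⟨e, he, Set.union_subset (h.trans (ball_mono h1)) (h'.trans (ball_mono h2))⟩)
    (fun x _ => by
      have h2 : ∃ c : F, c ≠ 0 ∧ x ∈ ball ι κ c := by
        have key : ∀ s : Finset (ι × κ), ∃ c : F, c ≠ 0 ∧
            ∀ i ∈ s, valuation F (x i.1 i.2) ≤ valuation F c := by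
          classical
          intro s
          induction s using Finset.induction_on with
          | empty => exact ⟨1, one_ne_zero, by simp⟩
          | insert a s _ ih =>
            obtain ⟨e, he, h⟩ := ih
            obtain ⟨e', he', h1, h2⟩ := exists_max e (x a.1 a.2) he
            refine ⟨e', he', fun i hi => ?_⟩
            rcases Finset.mem_insert.1 hi with rfl | hi
            · exact h2
            · exact (h i hi).trans h1
        obtain ⟨c, hc, h⟩ := key Finset.univ
        exact ⟨c, hc, fun i j => h (i, j) (Finset.mem_univ _)⟩
      obtain ⟨c, hc, hx⟩ := h2
      exact ⟨_, mem_nhdsWithin_of_mem_nhds ((isOpen_ball hc).mem_nhds hx), c, hc, le_rfl⟩)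
  exact h

/-- A function of two matrix variables is Schwartz--Bruhat iff it is invariant under small
translations and vanishes outside a bounded set. -/
theorem mem_schwartzBruhat_prod_iff {f : Matrix ι κ F × Matrix ι κ F → ℂ} :
    f ∈ schwartzBruhat (Matrix ι κ F × Matrix ι κ F) ↔
      ∃ c M : F, c ≠ 0 ∧ M ≠ 0 ∧
        (∀ x a u w, u ∈ ball ι κ c → w ∈ ball ι κ c → f (x + u, a + w) = f (x, a)) ∧
        (∀ x a, f (x, a) ≠ 0 → x ∈ ball ι κ M ∧ a ∈ ball ι κ M) := by
  constructor
  · rintro ⟨hl, hs⟩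
    have h0 : ∀ z, f z ≠ 0 → z ∈ tsupport f := fun z hz => subset_tsupport f hz
    obtain ⟨M₁, hM₁, hK₁⟩ := exists_subset_ball (hs.isCompact.image continuous_fst)
    obtain ⟨M₂, hM₂, hK₂⟩ := exists_subset_ball (hs.isCompact.image continuous_snd)
    obtain ⟨M, hM, h1, h2⟩ := exists_max M₁ M₂ hM₁
    have h := hs.isCompact.induction_on (p := fun s => ∃ c : F, c ≠ 0 ∧
        ∀ z ∈ s, ∀ u w, u ∈ ball ι κ c → w ∈ ball ι κ c → f (z + (u, w)) = f z)
      ⟨1, one_ne_zero, by simp⟩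
      (fun s t hst ⟨c, hc, h⟩ => ⟨c, hc, fun z hz => h z (hst hz)⟩)
      (fun s t ⟨c, hc, h⟩ ⟨d, hd, h'⟩ => by
        obtain ⟨e, he, h1, h2⟩ := exists_min c d hc hd
        refine ⟨e, he, fun z hz u w hu hw => ?_⟩
        rcases hz with hz | hz
        · exact h z hz u w (ball_mono h1 hu) (ball_mono h1 hw)
        · exact h' z hz u w (ball_mono h2 hu) (ball_mono h2 hw))
      (fun z _ => by
        have hz : {y | f (z + y) = f z} ∈ nhds (0 : Matrix ι κ F × Matrix ι κ F) := by
          have h3 := hl.eventually_eq z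
          have h4 : Filter.Tendsto (fun y => z + y) (nhds 0) (nhds z) := by
            have : Continuous fun y => z + y := by fun_prop
            simpa using this.tendsto 0
          exact h4.eventually h3
        obtain ⟨U, hU, V, hV, hUV⟩ := mem_nhds_prod_iff.1 hz
        obtain ⟨c, hc, hcU⟩ := exists_ball_subset hU
        obtain ⟨d, hd, hdV⟩ := exists_ball_subset hV
        obtain ⟨e, he, h1, h2⟩ := exists_min c d hc hd
        have hball : ∀ u w, u ∈ ball ι κ e → w ∈ ball ι κ e → f (z + (u, w)) = f z :=
          fun u w hu hw => hUV (Set.mk_mem_prod (hcU (ball_mono h1 hu)) (hdV (ball_mono h2 hw)))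
        refine ⟨{y | y.1 - z.1 ∈ ball ι κ e ∧ y.2 - z.2 ∈ ball ι κ e}, ?_, e, he, ?_⟩
        · refine mem_nhdsWithin_of_mem_nhds (IsOpen.mem_nhds ?_ ?_)
          · exact ((isOpen_ball he).preimage (by fun_prop :
                Continuous fun y : Matrix ι κ F × Matrix ι κ F => y.1 - z.1)).inter
              ((isOpen_ball he).preimage (by fun_prop :
                Continuous fun y : Matrix ι κ F × Matrix ι κ F => y.2 - z.2))
          · change z.1 - z.1 ∈ ball ι κ e ∧ z.2 - z.2 ∈ ball ι κ e
            simp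
        · rintro y ⟨hy1, hy2⟩ u w hu hw
          have e1 := hball _ _ (add_mem hy1 hu) (add_mem hy2 hw)
          have e2 := hball _ _ hy1 hy2
          have e3 : z + (y.1 - z.1 + u, y.2 - z.2 + w) = y + (u, w) := by
            ext <;> simp <;> ring
          have e4 : z + (y.1 - z.1, y.2 - z.2) = y := by
            ext <;> simp
          rw [e3] at e1
          rw [e4] at e2
          rw [e1, e2])
    obtain ⟨c, hc, h⟩ := h
    refine ⟨c, M, hc, hM, fun x a u w hu hw => ?_, fun x a hxa =>
      ⟨ball_mono h1 (hK₁ ⟨_, h0 _ hxa, rfl⟩), ball_mono h2 (hK₂ ⟨_, h0 _ hxa, rfl⟩)⟩⟩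
    by_cases h3 : (x, a) ∈ tsupport f
    · exact h _ h3 u w hu hw
    by_cases h4 : (x + u, a + w) ∈ tsupport f
    · have h5 := h _ h4 (-u) (-w) (neg_mem hu) (neg_mem hw)
      simp only [Prod.mk_add_mk, add_neg_cancel_right] at h5
      exact h5.symm
    · rw [image_eq_zero_of_notMem_tsupport h3, image_eq_zero_of_notMem_tsupport h4]
  · rintro ⟨c, M, hc, hM, hinv, hsupp⟩
    constructor
    · rw [IsLocallyConstant.iff_eventually_eq]
      rintro ⟨x, a⟩
      have hopen : IsOpen {y : Matrix ι κ F × Matrix ι κ F |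
          y.1 - x ∈ ball ι κ c ∧ y.2 - a ∈ ball ι κ c} :=
        ((isOpen_ball hc).preimage (by fun_prop :
            Continuous fun y : Matrix ι κ F × Matrix ι κ F => y.1 - x)).inter
          ((isOpen_ball hc).preimage (by fun_prop :
            Continuous fun y : Matrix ι κ F × Matrix ι κ F => y.2 - a))
      filter_upwards [hopen.mem_nhds (by
        change x - x ∈ ball ι κ c ∧ a - a ∈ ball ι κ c
        simp)]
      rintro ⟨y, b⟩ ⟨h1, h2⟩
      simpa using hinv x a (y - x) (b - a) h1 h2
    · refine HasCompactSupport.intro' (K := (ball ι κ M : Set _) ×ˢ (ball ι κ M : Set _))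
        ((isCompact_ball M).prod (isCompact_ball M)) ((isClosed_ball hM).prod (isClosed_ball hM)) ?_
      rintro ⟨x, a⟩ hxa
      by_contra h
      exact hxa (hsupp x a h)

theorem isOpen_openBall {c : F} (hc : c ≠ 0) :
    IsOpen {x : F | valuation F x < valuation F c} := by
  have hc' : valuation F c ≠ 0 := by simpa
  let L : AddSubgroup F :=
    { carrier := {x : F | valuation F x < valuation F c}
      zero_mem' := by
        change valuation F 0 < valuation F c
        simpa using zero_lt_iff.2 hc'
      add_mem' := fun {x y} hx hy => by
        change valuation F (x + y) < valuation F c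
        exact (Valuation.map_add _ x y).trans_lt (max_lt hx hy)
      neg_mem' := fun {x} hx => by simpa using hx }
  exact AddSubgroup.isOpen_of_mem_nhds L (g := 0)
    ((IsValuativeTopology.hasBasis_nhds_zero' F).mem_iff.2 ⟨valuation F c, hc', le_rfl⟩)

theorem circle_eq_one_of_pow_near {z : Circle} (h : ∀ n : ℕ, ‖((z ^ n : Circle) : ℂ) - 1‖ ≤ 1 / 2) :
    z = 1 := by
  by_contra hz
  have hz' : (z : ℂ) - 1 ≠ 0 := by
    rw [sub_ne_zero]
    intro h'
    exact hz (Circle.ext (by simpa using h'))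
  have key : ∀ k : ℕ, (3 / 2 : ℝ) ^ k * ‖(z : ℂ) - 1‖ ≤ ‖((z ^ (2 ^ k) : Circle) : ℂ) - 1‖ := by
    intro k
    induction k with
    | zero => simp
    | succ k ih =>
      set w : ℂ := ((z ^ (2 ^ k) : Circle) : ℂ) with hw
      have e1 : ((z ^ (2 ^ (k + 1)) : Circle) : ℂ) - 1 = (w - 1) * (w + 1) := by
        rw [pow_succ 2 k, pow_mul]
        simp only [Circle.coe_pow] at hw ⊢
        rw [← hw]
        ring
      have e2 : (3 / 2 : ℝ) ≤ ‖w + 1‖ := by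
        have h3 : ‖(2 : ℂ)‖ ≤ ‖w + 1‖ + ‖w - 1‖ := by
          have : (2 : ℂ) = (w + 1) - (w - 1) := by ring
          rw [this]
          exact norm_sub_le _ _
        have h4 := h (2 ^ k)
        rw [Complex.norm_ofNat] at h3
        linarith
      rw [e1, norm_mul, pow_succ]
      calc (3 / 2 : ℝ) ^ k * (3 / 2) * ‖(z : ℂ) - 1‖
          = (3 / 2 : ℝ) ^ k * ‖(z : ℂ) - 1‖ * (3 / 2) := by ring
        _ ≤ ‖w - 1‖ * ‖w + 1‖ := by gcongr
  obtain ⟨k, hk⟩ := pow_unbounded_of_one_lt (1 / ‖(z : ℂ) - 1‖) (by norm_num : (1 : ℝ) < 3 / 2)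
  have h1 := key k
  have h2 := h (2 ^ k)
  have h3 : (0 : ℝ) < ‖(z : ℂ) - 1‖ := norm_pos_iff.2 hz'
  rw [div_lt_iff₀ h3] at hk
  linarith

/-- A nontrivial continuous additive character has a conductor. -/
theorem exists_conductor {ψ : AddChar F Circle} (hψ : Continuous ψ) (hψ1 : ψ ≠ 1) :
    ∃ d : F, d ≠ 0 ∧ ∀ y : F, (∀ t, valuation F t ≤ 1 → ψ (t * y) = 1) ↔
      valuation F y ≤ valuation F d := by
  set G : Set F := {y | ∀ t, valuation F t ≤ 1 → ψ (t * y) = 1} with hG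
  have memG : ∀ y, y ∈ G ↔ ∀ t, valuation F t ≤ 1 → ψ (t * y) = 1 := fun y => Iff.rfl
  have down : ∀ y d, valuation F y ≤ valuation F d → d ∈ G → y ∈ G := by
    intro y d hyd hd
    by_cases h0 : d = 0
    · have : y = 0 := by simpa [h0] using hyd
      rw [this, ← h0]; exact hd
    have hd0 : valuation F d ≠ 0 := by simpa
    rw [memG]
    intro t ht
    have e : t * y = (t * (y / d)) * d := by field_simp
    rw [e]
    apply hd
    rw [map_mul, map_div₀]
    exact mul_le_one' ht (div_le_one_of_le₀ hyd zero_le)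
  have hclosed : IsClosed G := by
    have : G = ⋂ t : F, ⋂ _ : valuation F t ≤ 1, {y | ψ (t * y) = 1} := by
      ext y; simp [memG]
    rw [this]
    exact isClosed_iInter fun t => isClosed_iInter fun _ =>
      isClosed_eq (hψ.comp (continuous_const.mul continuous_id)) continuous_const
  obtain ⟨s, hs⟩ : ∃ s, ψ s ≠ 1 := by
    by_contra! h
    exact hψ1 (DFunLike.ext _ _ fun x => by simpa using h x)
  have hbd : ∀ y ∈ G, valuation F y ≤ valuation F s := by
    intro y hy
    by_contra! hlt
    have := down s y hlt.le hy 1 (by simp)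
    rw [one_mul] at this
    exact hs this
  have hcpt : IsCompact G :=
    (IsNonarchimedeanLocalField.isCompact_closedBall F (valuation F s)).of_isClosed_subset
      hclosed hbd
  obtain ⟨c, hc0, hcG⟩ : ∃ c, c ≠ 0 ∧ c ∈ G := by
    have hV : {x : F | ‖((ψ x : Circle) : ℂ) - 1‖ < 1 / 2} ∈ nhds (0 : F) := by
      have hcont : Continuous fun x : F => ‖((ψ x : Circle) : ℂ) - 1‖ :=
        ((continuous_subtype_val.comp hψ).sub continuous_const).norm
      exact (isOpen_lt hcont continuous_const).mem_nhds (by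
        change ‖((ψ 0 : Circle) : ℂ) - 1‖ < 1 / 2
        simp)
    obtain ⟨c, hc, h⟩ := exists_ball_subset (ι := Unit) (κ := Unit)
      (U := (fun x : Matrix Unit Unit F => x () ()) ⁻¹'
        {x : F | ‖((ψ x : Circle) : ℂ) - 1‖ < 1 / 2})
      ((Continuous.matrix_elem continuous_id () ()).continuousAt.preimage_mem_nhds hV)
    refine ⟨c, hc, fun t ht => circle_eq_one_of_pow_near fun n => ?_⟩
    rw [← AddChar.map_nsmul_eq_pow]
    have hmem : (fun _ _ => n • (t * c) : Matrix Unit Unit F) ∈ ball Unit Unit c := by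
      have : (fun _ _ => n • (t * c) : Matrix Unit Unit F) =
          n • (fun _ _ => t * c : Matrix Unit Unit F) := rfl
      rw [this]
      refine AddSubgroup.nsmul_mem _ (fun _ _ => ?_) n
      change valuation F (t * c) ≤ _
      rw [map_mul]
      exact mul_le_of_le_one_left' ht
    exact le_of_lt (h hmem)
  obtain ⟨d, hdG, hd⟩ : ∃ d ∈ G, ∀ y ∈ G, valuation F y ≤ valuation F d := by
    by_contra! hno
    obtain ⟨y, hy, hlt⟩ := hcpt.induction_on (p := fun s => ∃ y ∈ G, ∀ x ∈ s,
        valuation F x < valuation F y)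
      ⟨c, hcG, by simp⟩
      (fun s t hst ⟨y, hy, h⟩ => ⟨y, hy, fun x hx => h x (hst hx)⟩)
      (fun s t ⟨y, hy, h⟩ ⟨z, hz, h'⟩ => by
        rcases le_total (valuation F y) (valuation F z) with hyz | hyz
        · exact ⟨z, hz, fun x hx => hx.elim (fun hx => (h x hx).trans_le hyz) (h' x)⟩
        · exact ⟨y, hy, fun x hx => hx.elim (h x) (fun hx => (h' x hx).trans_le hyz)⟩)
      (fun d hd => by
        obtain ⟨y, hy, hlt⟩ := hno d hd
        have hy0 : y ≠ 0 := by rintro rfl; simp at hlt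
        exact ⟨_, mem_nhdsWithin_of_mem_nhds ((isOpen_openBall hy0).mem_nhds hlt), y, hy,
          fun x hx => hx⟩)
    exact lt_irrefl _ (hlt y hy)
  refine ⟨d, ?_, fun y => ⟨fun hy => hd y hy, fun hy => down y d hy hdG⟩⟩
  rintro rfl
  have := hd c hcG
  simp [hc0] at this

/-- The standard bilinear pairing of matrices of the same shape. -/
def pairing (X Y : Matrix ι κ F) : F := ∑ i, ∑ j, X i j * Y i j

theorem pairing_add_left (X X' Y : Matrix ι κ F) :
    pairing (X + X') Y = pairing X Y + pairing X' Y := by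
  simp [pairing, add_mul, Finset.sum_add_distrib]

theorem pairing_comm (X Y : Matrix ι κ F) : pairing X Y = pairing Y X := by
  simp [pairing, mul_comm]

theorem pairing_add_right (X Y Y' : Matrix ι κ F) :
    pairing X (Y + Y') = pairing X Y + pairing X Y' := by
  rw [pairing_comm, pairing_add_left, pairing_comm Y, pairing_comm Y']

theorem continuous_pairing :
    Continuous fun z : Matrix ι κ F × Matrix ι κ F => pairing z.1 z.2 :=
  continuous_finsetSum _ fun i _ => continuous_finsetSum _ fun j _ =>
    (continuous_fst.matrix_elem i j).mul (continuous_snd.matrix_elem i j)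

theorem exists_dual {ψ : AddChar F Circle} (hψ : Continuous ψ) (hψ1 : ψ ≠ 1) :
    ∃ d : F, d ≠ 0 ∧ ∀ c : F, c ≠ 0 → ∀ b : Matrix ι κ F,
      b ∈ ball ι κ (d / c) ↔ ∀ x ∈ ball ι κ c, ψ (pairing x b) = 1 := by
  classical
  obtain ⟨d, hd, h⟩ := exists_conductor hψ hψ1
  refine ⟨d, hd, fun c hc b => ⟨fun hb x hx => ?_, fun hb i j => ?_⟩⟩
  · have hc' : valuation F c ≠ 0 := by simpa
    have hxb : ∀ i j, ψ (x i j * b i j) = 1 := by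
      intro i j
      have h1 := (h (c * b i j)).2 (by
        have := hb i j
        rw [map_div₀, le_div_iff₀ (zero_lt_iff.2 hc')] at this
        rwa [map_mul, mul_comm])
      have h2 := h1 (x i j / c) (by
        rw [map_div₀]
        exact div_le_one_of_le₀ (hx i j) zero_le)
      rwa [show x i j / c * (c * b i j) = x i j * b i j by field_simp] at h2
    have hadd : ∀ s t : F, ψ s = 1 → ψ t = 1 → ψ (s + t) = 1 := fun s t hs ht => by
      rw [AddChar.map_add_eq_mul, hs, ht, one_mul]
    exact Finset.sum_induction _ (fun t => ψ t = 1) hadd ψ.map_zero_eq_one fun i _ =>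
      Finset.sum_induction _ (fun t => ψ t = 1) hadd ψ.map_zero_eq_one fun j _ => hxb i j
  · have hc' : valuation F c ≠ 0 := by simpa
    rw [map_div₀, le_div_iff₀ (zero_lt_iff.2 hc'), ← map_mul]
    refine (h _).1 fun t ht => ?_
    have h1 := hb (Matrix.single i j (t * c)) (fun i' j' => by
      rw [Matrix.single_apply]
      split_ifs
      · rw [map_mul]; exact mul_le_of_le_one_left' ht
      · simp)
    have h2 : pairing (Matrix.single i j (t * c)) b = t * (b i j * c) := by
      rw [pairing, Finset.sum_eq_single i, Finset.sum_eq_single j]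
      · simp; ring
      · intro j' _ hj; simp [hj.symm]
      · simp
      · intro i' _ hi; simp [hi.symm]
      · simp
    rwa [h2] at h1

/-- The partial Fourier transform, in the first variable, of a function of two matrix variables. -/
def partialFourierFun (ψ : AddChar F Circle) (f : Matrix ι κ F × Matrix ι κ F → ℂ)
    (z : Matrix ι κ F × Matrix ι κ F) : ℂ :=
  haarIntegral fun x : Matrix ι κ F => f (x, z.2) * (ψ (pairing x z.1) : ℂ)

theorem addChar_add (ψ : AddChar F Circle) (s t : F) :
    (ψ (s + t) : ℂ) = (ψ s : ℂ) * (ψ t : ℂ) := by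
  rw [AddChar.map_add_eq_mul, Circle.coe_mul]

theorem partialFourier_support {ψ : AddChar F Circle} {d : F}
    (hd : ∀ c : F, c ≠ 0 → ∀ b : Matrix ι κ F,
      b ∈ ball ι κ (d / c) ↔ ∀ x ∈ ball ι κ c, ψ (pairing x b) = 1)
    {f : Matrix ι κ F × Matrix ι κ F → ℂ} {c : F} (hc : c ≠ 0)
    (hinv : ∀ x a u w, u ∈ ball ι κ c → w ∈ ball ι κ c → f (x + u, a + w) = f (x, a))
    (b a : Matrix ι κ F) (h : partialFourierFun ψ f (b, a) ≠ 0) : b ∈ ball ι κ (d / c) := by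
  rw [hd c hc]
  intro u hu
  have e1 := haarIntegral_translate (fun x : Matrix ι κ F => f (x, a) * (ψ (pairing x b) : ℂ)) u
  have e2 : (fun x : Matrix ι κ F => f (x + u, a) * (ψ (pairing (x + u) b) : ℂ)) =
      fun x => (ψ (pairing u b) : ℂ) * (f (x, a) * (ψ (pairing x b) : ℂ)) := by
    funext x
    have := hinv x a u 0 hu (zero_mem _)
    rw [add_zero] at this
    rw [this, pairing_add_left, addChar_add]
    ring
  rw [e2, haarIntegral_const_mul] at e1
  have e3 : (ψ (pairing u b) : ℂ) = 1 := mul_right_cancel₀ h (by rw [one_mul]; exact e1)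
  exact Circle.ext (by simpa using e3)

theorem partialFourierFun_mem {ψ : AddChar F Circle} (hψ : Continuous ψ) (hψ1 : ψ ≠ 1)
    {f : Matrix ι κ F × Matrix ι κ F → ℂ}
    (hf : f ∈ schwartzBruhat (Matrix ι κ F × Matrix ι κ F)) :
    partialFourierFun ψ f ∈ schwartzBruhat (Matrix ι κ F × Matrix ι κ F) := by
  obtain ⟨c, M, hc, hM, hinv, hsupp⟩ := mem_schwartzBruhat_prod_iff.1 hf
  obtain ⟨d, hd0, hd⟩ := exists_dual (ι := ι) (κ := κ) hψ hψ1
  obtain ⟨e, he, he1, he2⟩ := exists_min (d / M) c (div_ne_zero hd0 hM) hc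
  obtain ⟨N, hN, hN1, hN2⟩ := exists_max (d / c) M (div_ne_zero hd0 hc)
  refine mem_schwartzBruhat_prod_iff.2 ⟨e, N, he, hN, fun b a u w hu hw => ?_, fun b a h =>
    ⟨ball_mono hN1 (partialFourier_support hd hc hinv b a h), ball_mono hN2 ?_⟩⟩
  · change haarIntegral _ = haarIntegral _
    congr 1
    funext x
    have h1 := hinv x a 0 w (zero_mem _) (ball_mono he2 hw)
    rw [add_zero] at h1
    change f (x, a + w) * (ψ (pairing x (b + u)) : ℂ) = f (x, a) * (ψ (pairing x b) : ℂ)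
    rw [h1]
    by_cases h2 : f (x, a) = 0
    · rw [h2, zero_mul, zero_mul]
    · rw [pairing_add_right, addChar_add, (hd M hM u).1 (ball_mono he1 hu) x (hsupp x a h2).1]
      simp
  · by_contra ha
    apply h
    have h0 : (fun x : Matrix ι κ F => f (x, a) * (ψ (pairing x b) : ℂ)) = fun x => 0 * 0 := by
      funext x
      have : f (x, a) = 0 := by
        by_contra h3
        exact ha (hsupp x a h3).2
      rw [this, zero_mul, zero_mul]
    change haarIntegral (fun x : Matrix ι κ F => f (x, a) * (ψ (pairing x b) : ℂ)) = 0
    rw [h0, haarIntegral_const_mul, zero_mul]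

open Classical in
theorem haarIntegral_ball_char {ψ : AddChar F Circle} {d : F} (hd0 : d ≠ 0)
    (hd : ∀ c : F, c ≠ 0 → ∀ b : Matrix ι κ F,
      b ∈ ball ι κ (d / c) ↔ ∀ x ∈ ball ι κ c, ψ (pairing x b) = 1) {c : F} (hc : c ≠ 0)
    (y : Matrix ι κ F) :
    haarIntegral (fun b : Matrix ι κ F =>
        (if b ∈ ball ι κ (d / c) then (1 : ℂ) else 0) * (ψ (pairing y b) : ℂ)) =
      (if y ∈ ball ι κ c then (1 : ℂ) else 0) *
        haarIntegral ((ball ι κ (d / c) : Set (Matrix ι κ F)).indicator fun _ => (1 : ℂ)) := by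
  have hdd : d / (d / c) = c := by field_simp
  split_ifs with hy
  · rw [one_mul]
    congr 1
    funext b
    by_cases hb : b ∈ ball ι κ (d / c)
    · rw [if_pos hb, Set.indicator_of_mem (by exact hb), pairing_comm,
        (hd (d / c) (div_ne_zero hd0 hc) y).1 (by rwa [hdd]) b hb]
      simp
    · rw [if_neg hb, Set.indicator_of_notMem (by exact hb), zero_mul]
  · rw [zero_mul]
    by_contra hI
    apply hy
    rw [← hdd, hd (d / c) (div_ne_zero hd0 hc) y]
    intro u hu
    have e1 := haarIntegral_translate (fun b : Matrix ι κ F =>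
        (if b ∈ ball ι κ (d / c) then (1 : ℂ) else 0) * (ψ (pairing y b) : ℂ)) u
    have e2 : (fun b : Matrix ι κ F =>
        (if b + u ∈ ball ι κ (d / c) then (1 : ℂ) else 0) * (ψ (pairing y (b + u)) : ℂ)) =
        fun b => (ψ (pairing y u) : ℂ) *
          ((if b ∈ ball ι κ (d / c) then (1 : ℂ) else 0) * (ψ (pairing y b) : ℂ)) := by
      funext b
      rw [pairing_add_right, addChar_add]
      have : b + u ∈ ball ι κ (d / c) ↔ b ∈ ball ι κ (d / c) :=
        (ball ι κ (d / c)).add_mem_cancel_right hu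
      simp only [this]
      ring
    rw [e2, haarIntegral_const_mul] at e1
    have e3 : (ψ (pairing y u) : ℂ) = 1 := mul_right_cancel₀ hI (by rw [one_mul]; exact e1)
    rw [pairing_comm]
    exact Circle.ext (by simpa using e3)

open Classical in
/-- Fourier inversion, up to a nonzero constant depending on the normalisation of measures. -/
theorem partialFourier_inversion {ψ : AddChar F Circle} (hψ : Continuous ψ) (hψ1 : ψ ≠ 1)
    {f : Matrix ι κ F × Matrix ι κ F → ℂ}
    (hf : f ∈ schwartzBruhat (Matrix ι κ F × Matrix ι κ F)) :
    ∃ C : ℂ, C ≠ 0 ∧ partialFourierFun ψ⁻¹ (partialFourierFun ψ f) = fun z => C * f z := by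
  obtain ⟨c, M, hc, hM, hinv, hsupp⟩ := mem_schwartzBruhat_prod_iff.1 hf
  obtain ⟨d, hd0, hd⟩ := exists_dual (ι := ι) (κ := κ) hψ hψ1
  have hdc : d / c ≠ 0 := div_ne_zero hd0 hc
  set A := haarIntegral ((ball ι κ (d / c) : Set (Matrix ι κ F)).indicator fun _ => (1 : ℂ))
    with hA
  set B := haarIntegral ((ball ι κ c : Set (Matrix ι κ F)).indicator fun _ => (1 : ℂ)) with hB
  refine ⟨A * B, mul_ne_zero
    (haarIntegral_subgroup_ne_zero _ (isOpen_ball hdc) (isCompact_ball _))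
    (haarIntegral_subgroup_ne_zero _ (isOpen_ball hc) (isCompact_ball _)), ?_⟩
  funext ⟨x, a⟩
  let g : Matrix ι κ F → Matrix ι κ F → ℂ := fun b y =>
    f (y, a) * ((if b ∈ ball ι κ (d / c) then (1 : ℂ) else 0) * (ψ (pairing (y - x) b) : ℂ))
  have step1 : partialFourierFun ψ⁻¹ (partialFourierFun ψ f) (x, a) =
      haarIntegral fun b => haarIntegral fun y => g b y := by
    change haarIntegral (fun b => partialFourierFun ψ f (b, a) * _) = _
    congr 1
    funext b
    by_cases hb : b ∈ ball ι κ (d / c)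
    · have : (fun y => g b y) = fun y => ((ψ⁻¹) (pairing b x) : ℂ) *
          (f (y, a) * (ψ (pairing y b) : ℂ)) := by
        funext y
        simp only [g, if_pos hb]
        rw [sub_eq_add_neg, pairing_add_left, addChar_add, AddChar.inv_apply, pairing_comm b x]
        have : pairing (-x) b = -pairing x b := by simp [pairing]
        rw [this]
        ring
      rw [this, haarIntegral_const_mul, mul_comm]
      rfl
    · have h0 : partialFourierFun ψ f (b, a) = 0 := by
        by_contra h
        exact hb (partialFourier_support hd hc hinv b a h)
      have : (fun y => g b y) = fun y => 0 * 0 := by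
        funext y
        simp only [g, if_neg hb, zero_mul, mul_zero]
      rw [h0, this, haarIntegral_const_mul, zero_mul, zero_mul]
  have hcont : Continuous g.uncurry := by
    have h1 : Continuous fun z : Matrix ι κ F × Matrix ι κ F => f (z.2, a) :=
      hf.1.continuous.comp (by fun_prop)
    have h2 : Continuous fun z : Matrix ι κ F × Matrix ι κ F =>
        (if z.1 ∈ ball ι κ (d / c) then (1 : ℂ) else 0) := by
      have h3 : IsClopen (ball ι κ (d / c) : Set (Matrix ι κ F)) :=
        ⟨isClosed_ball hdc, isOpen_ball hdc⟩
      have h4 := Continuous.indicator (f := fun _ : Matrix ι κ F => (1 : ℂ))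
        (s := (ball ι κ (d / c) : Set (Matrix ι κ F)))
        (fun x hx => by simp [h3.frontier_eq] at hx) continuous_const
      refine (h4.comp continuous_fst).congr fun z => ?_
      by_cases hz : z.1 ∈ ball ι κ (d / c)
      · rw [if_pos hz]; exact Set.indicator_of_mem (by exact hz) _
      · rw [if_neg hz]; exact Set.indicator_of_notMem (by exact hz) _
    have h3 : Continuous fun z : Matrix ι κ F × Matrix ι κ F => (ψ (pairing (z.2 - x) z.1) : ℂ) :=
      continuous_subtype_val.comp (hψ.comp (continuous_pairing.comp
        ((continuous_snd.sub continuous_const).prodMk continuous_fst)))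
    exact h1.mul (h2.mul h3)
  have hcs : HasCompactSupport g.uncurry := by
    refine HasCompactSupport.intro' (K := (ball ι κ (d / c) : Set _) ×ˢ (ball ι κ M : Set _))
      ((isCompact_ball _).prod (isCompact_ball M))
      ((isClosed_ball hdc).prod (isClosed_ball hM)) ?_
    rintro ⟨b, y⟩ hby
    by_contra h
    apply hby
    change g b y ≠ 0 at h
    refine ⟨?_, ?_⟩
    · by_contra hb
      apply h
      have hb' : b ∉ ball ι κ (d / c) := hb
      simp only [g, if_neg hb', zero_mul, mul_zero]
    · by_contra hy
      apply h
      have : f (y, a) = 0 := by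
        by_contra h3
        exact hy (hsupp y a h3).1
      simp only [g, this, zero_mul]
  rw [step1, haarIntegral_swap hcont hcs]
  have step2 : (fun y => haarIntegral fun b => g b y) = fun y => (A * f (x, a)) *
      (ball ι κ c : Set (Matrix ι κ F)).indicator (fun _ => (1 : ℂ)) (y + -x) := by
    funext y
    simp only [g]
    rw [haarIntegral_const_mul, haarIntegral_ball_char hd0 hd hc (y - x), ← hA, ← sub_eq_add_neg]
    by_cases hy : y - x ∈ ball ι κ c
    · rw [if_pos hy, Set.indicator_of_mem (by exact hy)]
      have := hinv x a (y - x) 0 hy (zero_mem _)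
      rw [add_zero, add_sub_cancel] at this
      rw [this]
      ring
    · rw [if_neg hy, Set.indicator_of_notMem (by exact hy)]
      ring
  rw [step2, haarIntegral_const_mul, haarIntegral_translate, ← hB]
  ring

theorem partialFourierFun_add {ψ : AddChar F Circle} (hψ : Continuous ψ)
    {f g : Matrix ι κ F × Matrix ι κ F → ℂ}
    (hf : f ∈ schwartzBruhat (Matrix ι κ F × Matrix ι κ F))
    (hg : g ∈ schwartzBruhat (Matrix ι κ F × Matrix ι κ F)) :
    partialFourierFun ψ (f + g) = partialFourierFun ψ f + partialFourierFun ψ g := by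
  funext ⟨b, a⟩
  have hc : Continuous fun x : Matrix ι κ F => (ψ (pairing x b) : ℂ) :=
    continuous_subtype_val.comp (hψ.comp (continuous_pairing.comp
      (continuous_id.prodMk continuous_const)))
  have key : ∀ f ∈ schwartzBruhat (Matrix ι κ F × Matrix ι κ F),
      Continuous (fun x : Matrix ι κ F => f (x, a) * (ψ (pairing x b) : ℂ)) ∧
      HasCompactSupport (fun x : Matrix ι κ F => f (x, a) * (ψ (pairing x b) : ℂ)) := by
    intro f hf
    obtain ⟨c, M, -, hM, -, hsupp⟩ := mem_schwartzBruhat_prod_iff.1 hf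
    refine ⟨(hf.1.continuous.comp (by fun_prop)).mul hc,
      HasCompactSupport.intro' (isCompact_ball M) (isClosed_ball hM) fun x hx => ?_⟩
    have : f (x, a) = 0 := by
      by_contra h
      exact hx (hsupp x a h).1
    rw [this, zero_mul]
  obtain ⟨h1, h2⟩ := key f hf
  obtain ⟨h3, h4⟩ := key g hg
  change haarIntegral (fun x : Matrix ι κ F => (f (x, a) + g (x, a)) * _) = _
  simp only [add_mul]
  exact haarIntegral_add h1 h2 h3 h4

/-- The partial Fourier transform as a linear endomorphism of the Schwartz--Bruhat space. -/
def partialFourierLinear {ψ : AddChar F Circle} (hψ : Continuous ψ) (hψ1 : ψ ≠ 1) :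
    schwartzBruhat (Matrix ι κ F × Matrix ι κ F) →ₗ[ℂ]
      schwartzBruhat (Matrix ι κ F × Matrix ι κ F) where
  toFun f := ⟨partialFourierFun ψ f.1, partialFourierFun_mem hψ hψ1 f.2⟩
  map_add' f g := Subtype.ext (partialFourierFun_add hψ f.2 g.2)
  map_smul' c f := Subtype.ext (by
    funext z
    change haarIntegral (fun x : Matrix ι κ F => (c * f.1 (x, z.2)) * _) = c * haarIntegral _
    simp only [mul_assoc]
    exact haarIntegral_const_mul _ _)

theorem partialFourierLinear_bijective {ψ : AddChar F Circle} (hψ : Continuous ψ) (hψ1 : ψ ≠ 1) :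
    Function.Bijective (partialFourierLinear (ι := ι) (κ := κ) hψ hψ1) := by
  have hψ' : Continuous (ψ⁻¹ : AddChar F Circle) := by
    have : ((ψ⁻¹ : AddChar F Circle) : F → Circle) = fun x => ψ (-x) := by
      funext x; rw [AddChar.inv_apply]
    rw [this]
    exact hψ.comp continuous_neg
  have hψ1' : ψ⁻¹ ≠ 1 := inv_ne_one.2 hψ1
  constructor
  · rw [← LinearMap.ker_eq_bot, LinearMap.ker_eq_bot']
    intro f hf
    obtain ⟨C, hC, h⟩ := partialFourier_inversion hψ hψ1 f.2
    have h0 : partialFourierFun ψ f.1 = 0 := congrArg Subtype.val hf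
    have h1 : partialFourierFun ψ⁻¹ (0 : Matrix ι κ F × Matrix ι κ F → ℂ) = 0 :=
      congrArg Subtype.val (map_zero (partialFourierLinear (ι := ι) (κ := κ) hψ' hψ1'))
    rw [h0, h1] at h
    refine Subtype.ext (funext fun z => ?_)
    have := congrFun h z
    exact (mul_eq_zero.1 this.symm).resolve_left hC
  · intro f
    obtain ⟨C, hC, h⟩ := partialFourier_inversion hψ' hψ1' f.2
    rw [inv_inv] at h
    refine ⟨C⁻¹ • partialFourierLinear hψ' hψ1' f, ?_⟩
    rw [map_smul]
    refine Subtype.ext (funext fun z => ?_)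
    change C⁻¹ * partialFourierFun ψ (partialFourierFun ψ⁻¹ f.1) z = f.1 z
    rw [h]
    field_simp

/-- The partial Fourier transform as an automorphism of the Schwartz--Bruhat space. -/
def partialFourier {ψ : AddChar F Circle} (hψ : Continuous ψ) (hψ1 : ψ ≠ 1) :
    schwartzBruhat (Matrix ι κ F × Matrix ι κ F) ≃ₗ[ℂ]
      schwartzBruhat (Matrix ι κ F × Matrix ι κ F) :=
  LinearEquiv.ofBijective _ (partialFourierLinear_bijective hψ hψ1)

end Lattices

section Groups

/-- The matrix `v_k` with ones on the second diagonal and zeros elsewhere. -/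
def antiDiag (F : Type*) [Field F] (k : ℕ) : Matrix (Fin k) (Fin k) F :=
  Matrix.of fun i j => if j = i.rev then 1 else 0

/-- The symmetric form `v_{2l}`, in block form. -/
def symForm (F : Type*) [Field F] (l : ℕ) : Matrix (Fin l ⊕ Fin l) (Fin l ⊕ Fin l) F :=
  Matrix.fromBlocks 0 (antiDiag F l) (antiDiag F l) 0

/-- The alternating form `J_{2l}`. -/
def altForm (F : Type*) [Field F] (l : ℕ) : Matrix (Fin l ⊕ Fin l) (Fin l ⊕ Fin l) F :=
  Matrix.fromBlocks 0 (antiDiag F l) (-antiDiag F l) 0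

/-- The group of all `g` in `GL` with `ᵗg S g = S`. -/
def isometryGroup {F : Type*} [Field F] {N : Type*} [Fintype N] [DecidableEq N]
    (S : Matrix N N F) : Subgroup (GL N F) where
  carrier := {g | (g : Matrix N N F)ᵀ * S * (g : Matrix N N F) = S}
  one_mem' := by simp
  mul_mem' {g h} hg hh := by
    change ((g * h : GL N F) : Matrix N N F)ᵀ * S * ((g * h : GL N F) : Matrix N N F) = S
    change (g : Matrix N N F)ᵀ * S * (g : Matrix N N F) = S at hg
    change (h : Matrix N N F)ᵀ * S * (h : Matrix N N F) = S at hh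
    rw [Units.val_mul, Matrix.transpose_mul]
    calc (h : Matrix N N F)ᵀ * (g : Matrix N N F)ᵀ * S * ((g : Matrix N N F) * (h : Matrix N N F))
        = (h : Matrix N N F)ᵀ * ((g : Matrix N N F)ᵀ * S * (g : Matrix N N F)) * h := by
          simp only [Matrix.mul_assoc]
      _ = S := by rw [hg, hh]
  inv_mem' {g} hg := by
    change ((g⁻¹ : GL N F) : Matrix N N F)ᵀ * S * ((g⁻¹ : GL N F) : Matrix N N F) = S
    change (g : Matrix N N F)ᵀ * S * (g : Matrix N N F) = S at hg
    have h1 : (g : Matrix N N F) * ((g⁻¹ : GL N F) : Matrix N N F) = 1 := by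
      rw [← Units.val_mul, mul_inv_cancel, Units.val_one]
    have h2 : ((g⁻¹ : GL N F) : Matrix N N F)ᵀ * (g : Matrix N N F)ᵀ = 1 := by
      rw [← Matrix.transpose_mul, h1, Matrix.transpose_one]
    calc ((g⁻¹ : GL N F) : Matrix N N F)ᵀ * S * ((g⁻¹ : GL N F) : Matrix N N F)
        = ((g⁻¹ : GL N F) : Matrix N N F)ᵀ *
            ((g : Matrix N N F)ᵀ * S * (g : Matrix N N F)) * ((g⁻¹ : GL N F) : Matrix N N F) := by
          rw [hg]
      _ = (((g⁻¹ : GL N F) : Matrix N N F)ᵀ * (g : Matrix N N F)ᵀ) * S *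
            ((g : Matrix N N F) * ((g⁻¹ : GL N F) : Matrix N N F)) := by
          simp only [Matrix.mul_assoc]
      _ = S := by rw [h1, h2, Matrix.one_mul, Matrix.mul_one]

/-- The group `Sp_{2l}(F)`. -/
def Sp (F : Type*) [Field F] (l : ℕ) : Subgroup (GL (Fin l ⊕ Fin l) F) :=
  isometryGroup (altForm F l)

/-- The split even special orthogonal group `SO_{2l}(F)`. -/
def SO (F : Type*) [Field F] (l : ℕ) : Subgroup (GL (Fin l ⊕ Fin l) F) :=
  isometryGroup (symForm F l) ⊓ (Matrix.GeneralLinearGroup.det).ker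

/-- The bijection of indices which puts the index set of `2a × 2a` matrices on the outside and
that of `2b × 2b` matrices on the inside. -/
def blockIndex {a b N : ℕ} (h : a + b = N) :
    (Fin a ⊕ Fin a) ⊕ (Fin b ⊕ Fin b) ≃ Fin N ⊕ Fin N :=
  (Equiv.sumSumSumComm _ _ _ _).trans
    (Equiv.sumCongr (finSumFinEquiv.trans (finCongr h))
      ((Equiv.sumComm _ _).trans (finSumFinEquiv.trans (finCongr ((add_comm b a).trans h)))))

/-- The block matrix
`[[A₁, 0, 0, B₁], [0, A₂, B₂, 0], [0, C₂, D₂, 0], [C₁, 0, 0, D₁]]`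
attached to `g₁ = [[A₁, B₁], [C₁, D₁]]` and `g₂ = [[A₂, B₂], [C₂, D₂]]`. -/
def blockMatrix {F : Type*} [Field F] {a b N : ℕ} (h : a + b = N)
    (g₁ : Matrix (Fin a ⊕ Fin a) (Fin a ⊕ Fin a) F) (g₂ : Matrix (Fin b ⊕ Fin b) (Fin b ⊕ Fin b) F) :
    Matrix (Fin N ⊕ Fin N) (Fin N ⊕ Fin N) F :=
  Matrix.reindex (blockIndex h) (blockIndex h) (Matrix.fromBlocks g₁ 0 0 g₂)

section Block
variable {F : Type*} [Field F] {a b N : ℕ} (h : a + b = N)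

theorem blockMatrix_mul (g₁ g₁' : Matrix (Fin a ⊕ Fin a) (Fin a ⊕ Fin a) F)
    (g₂ g₂' : Matrix (Fin b ⊕ Fin b) (Fin b ⊕ Fin b) F) :
    blockMatrix h g₁ g₂ * blockMatrix h g₁' g₂' = blockMatrix h (g₁ * g₁') (g₂ * g₂') := by
  simp only [blockMatrix, Matrix.reindex_apply]
  rw [Matrix.submatrix_mul_equiv, Matrix.fromBlocks_multiply]
  simp

theorem blockMatrix_one :
    blockMatrix h (1 : Matrix (Fin a ⊕ Fin a) (Fin a ⊕ Fin a) F)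
      (1 : Matrix (Fin b ⊕ Fin b) (Fin b ⊕ Fin b) F) = 1 := by
  simp [blockMatrix]

theorem blockMatrix_transpose (g₁ : Matrix (Fin a ⊕ Fin a) (Fin a ⊕ Fin a) F)
    (g₂ : Matrix (Fin b ⊕ Fin b) (Fin b ⊕ Fin b) F) :
    (blockMatrix h g₁ g₂)ᵀ = blockMatrix h g₁ᵀ g₂ᵀ := by
  simp only [blockMatrix, Matrix.reindex_apply, Matrix.transpose_submatrix,
    Matrix.fromBlocks_transpose, Matrix.transpose_zero]

theorem blockMatrix_det (g₁ : Matrix (Fin a ⊕ Fin a) (Fin a ⊕ Fin a) F)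
    (g₂ : Matrix (Fin b ⊕ Fin b) (Fin b ⊕ Fin b) F) :
    (blockMatrix h g₁ g₂).det = g₁.det * g₂.det := by
  rw [blockMatrix, Matrix.det_reindex_self, Matrix.det_fromBlocks_zero₂₁]

theorem blockMatrix_form (s : F) :
    blockMatrix h (Matrix.fromBlocks 0 (antiDiag F a) (s • antiDiag F a) 0)
      (Matrix.fromBlocks 0 (antiDiag F b) (s • antiDiag F b) 0) =
      Matrix.fromBlocks 0 (antiDiag F N) (s • antiDiag F N) 0 := by
  subst h
  rw [blockMatrix, ← Equiv.eq_symm_apply]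
  ext i j
  rcases i with (i | i) | (i | i) <;> rcases j with (j | j) | (j | j) <;>
    simp [blockIndex, antiDiag, Fin.ext_iff] <;>
    first | omega | (congr 1; ext; omega)

/-- The block embedding of `GL_{2a} × GL_{2b}` into `GL_{2a+2b}`. -/
def blockGL (g₁ : GL (Fin a ⊕ Fin a) F) (g₂ : GL (Fin b ⊕ Fin b) F) : GL (Fin N ⊕ Fin N) F where
  val := blockMatrix h g₁ g₂
  inv := blockMatrix h (g₁⁻¹ : GL _ F) (g₂⁻¹ : GL _ F)
  val_inv := by
    rw [blockMatrix_mul, ← Units.val_mul, ← Units.val_mul, mul_inv_cancel, mul_inv_cancel]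
    exact blockMatrix_one h
  inv_val := by
    rw [blockMatrix_mul, ← Units.val_mul, ← Units.val_mul, inv_mul_cancel, inv_mul_cancel]
    exact blockMatrix_one h

theorem blockGL_mem_isometryGroup {s : F} {g₁ : GL (Fin a ⊕ Fin a) F} {g₂ : GL (Fin b ⊕ Fin b) F}
    (h₁ : g₁ ∈ isometryGroup (Matrix.fromBlocks 0 (antiDiag F a) (s • antiDiag F a) 0))
    (h₂ : g₂ ∈ isometryGroup (Matrix.fromBlocks 0 (antiDiag F b) (s • antiDiag F b) 0)) :
    blockGL h g₁ g₂ ∈ isometryGroup (Matrix.fromBlocks 0 (antiDiag F N) (s • antiDiag F N) 0) := by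
  change (blockMatrix h (g₁ : Matrix _ _ F) (g₂ : Matrix _ _ F))ᵀ * _ *
    blockMatrix h (g₁ : Matrix _ _ F) (g₂ : Matrix _ _ F) = _
  rw [← blockMatrix_form h s, blockMatrix_transpose, blockMatrix_mul, blockMatrix_mul]
  congr 1

theorem blockGL_mem_Sp {g₁ : GL (Fin a ⊕ Fin a) F} {g₂ : GL (Fin b ⊕ Fin b) F}
    (h₁ : g₁ ∈ Sp F a) (h₂ : g₂ ∈ Sp F b) : blockGL h g₁ g₂ ∈ Sp F N := by
  have key : ∀ l, Sp F l = isometryGroup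
      (Matrix.fromBlocks 0 (antiDiag F l) ((-1 : F) • antiDiag F l) 0) := fun l => by
    rw [neg_one_smul, Sp, altForm]
  rw [key] at h₁ h₂ ⊢
  exact blockGL_mem_isometryGroup h h₁ h₂

theorem blockGL_mem_SO {g₁ : GL (Fin a ⊕ Fin a) F} {g₂ : GL (Fin b ⊕ Fin b) F}
    (h₁ : g₁ ∈ SO F a) (h₂ : g₂ ∈ SO F b) : blockGL h g₁ g₂ ∈ SO F N := by
  have key : ∀ l, symForm F l =
      Matrix.fromBlocks 0 (antiDiag F l) ((1 : F) • antiDiag F l) 0 := fun l => by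
    rw [one_smul, symForm]
  obtain ⟨hf₁, hd₁⟩ := h₁
  obtain ⟨hf₂, hd₂⟩ := h₂
  refine ⟨?_, Units.ext ?_⟩
  · rw [key] at hf₁ hf₂ ⊢
    exact blockGL_mem_isometryGroup h hf₁ hf₂
  · have e₁ : Matrix.det (g₁ : Matrix (Fin a ⊕ Fin a) (Fin a ⊕ Fin a) F) = 1 :=
      congrArg Units.val hd₁
    have e₂ : Matrix.det (g₂ : Matrix (Fin b ⊕ Fin b) (Fin b ⊕ Fin b) F) = 1 :=
      congrArg Units.val hd₂
    change Matrix.det (blockMatrix h (g₁ : Matrix (Fin a ⊕ Fin a) (Fin a ⊕ Fin a) F)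
      (g₂ : Matrix (Fin b ⊕ Fin b) (Fin b ⊕ Fin b) F)) = 1
    rw [blockMatrix_det, e₁, e₂, one_mul]

/-- The embedding of `Sp_{2a} × Sp_{2b}` into `Sp_{2a+2b}`. -/
def spBlock (g₁ : Sp F a) (g₂ : Sp F b) : Sp F N :=
  ⟨blockGL h g₁ g₂, blockGL_mem_Sp h g₁.2 g₂.2⟩

/-- The embedding of `SO_{2a} × SO_{2b}` into `SO_{2a+2b}`. -/
def soBlock (g₁ : SO F a) (g₂ : SO F b) : SO F N :=
  ⟨blockGL h g₁ g₂, blockGL_mem_SO h g₁.2 g₂.2⟩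

end Block
end Groups

section Representations

/-- An irreducible admissible representation: irreducible, smooth (every vector has an open
stabilizer), and with finite-dimensional spaces of vectors fixed by compact open subgroups. -/
structure IsIrreducibleAdmissible {G V : Type*} [Group G] [TopologicalSpace G] [AddCommGroup V]
    [Module ℂ V] (ρ : Representation ℂ G V) : Prop where
  irreducible : ρ.IsIrreducible
  smooth : ∀ v : V, IsOpen {g : G | ρ g v = v}
  admissible : ∀ K : Subgroup G, IsOpen (K : Set G) → IsCompact (K : Set G) →
    FiniteDimensional ℂ (Representation.invariants (ρ.comp K.subtype))

/-- `π` has a nonzero generalized symplectic linear model relative to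
`Sp_{2a} × Sp_{2b} ⊆ Sp_{2N}`. -/
def HasSymplecticLinearModel {F : Type*} [Field F] {a b N : ℕ} (h : a + b = N) {V : Type*}
    [AddCommGroup V] [Module ℂ V] (π : Representation ℂ (Sp F N) V) : Prop :=
  ∃ l : V →ₗ[ℂ] ℂ, l ≠ 0 ∧ ∀ (g₁ : Sp F a) (g₂ : Sp F b) (v : V), l (π (spBlock h g₁ g₂) v) = l v

/-- `σ` has a nonzero generalized orthogonal linear model relative to
`SO_{2a} × SO_{2b} ⊆ SO_{2N}`. -/
def HasOrthogonalLinearModel {F : Type*} [Field F] {a b N : ℕ} (h : a + b = N) {V : Type*}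
    [AddCommGroup V] [Module ℂ V] (σ : Representation ℂ (SO F N) V) : Prop :=
  ∃ l : V →ₗ[ℂ] ℂ, l ≠ 0 ∧ ∀ (g₁ : SO F a) (g₂ : SO F b) (v : V), l (σ (soBlock h g₁ g₂) v) = l v

/-- `Hom_{G × H}(ω, σ ⊗ π) ≠ 0`, where the `G × H`-module `ω` is given by the actions of its two
factors. -/
def Corresponds {G H S U V : Type*} [Group G] [Group H] [AddCommGroup S] [Module ℂ S]
    [AddCommGroup U] [Module ℂ U] [AddCommGroup V] [Module ℂ V] (ωG : Representation ℂ G S)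
    (ωH : Representation ℂ H S) (σ : Representation ℂ G U) (π : Representation ℂ H V) : Prop :=
  ∃ T : S →ₗ[ℂ] U ⊗[ℂ] V, T ≠ 0 ∧
    (∀ g φ, T (ωG g φ) = TensorProduct.map (σ g) LinearMap.id (T φ)) ∧
    (∀ h φ, T (ωH h φ) = TensorProduct.map LinearMap.id (π h) (T φ))

section BigTheta
variable {G H S : Type*} [Group G] [Group H] [AddCommGroup S] [Module ℂ S]
  (ωG : Representation ℂ G S) (ωH : Representation ℂ H S)

/-- The smallest `G`-stable subspace which contains all `ω(h)φ - φ` with `h` in `H`. As the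
actions of `G` and `H` commute, it is the span of these vectors. -/
def thetaKernel : Submodule ℂ S :=
  Submodule.span ℂ {s | ∃ g h φ, s = ωG g (ωH h φ - φ)}

theorem thetaKernel_le_comap (g : G) : thetaKernel ωG ωH ≤ (thetaKernel ωG ωH).comap (ωG g) := by
  rw [thetaKernel, Submodule.span_le]
  rintro _ ⟨g', h, φ, rfl⟩
  exact Submodule.subset_span ⟨g * g', h, φ, by rw [map_mul]; rfl⟩

/-- The representation of `G` on the maximal quotient of `ω` on which `H` acts trivially. -/
def bigTheta : Representation ℂ G (S ⧸ thetaKernel ωG ωH) :=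
  ωG.quotient (thetaKernel ωG ωH) (thetaKernel_le_comap ωG ωH)

end BigTheta

/-- Transport of a representation along a linear isomorphism. -/
def transport {G S S' : Type*} [Group G] [AddCommGroup S] [Module ℂ S] [AddCommGroup S']
    [Module ℂ S'] (e : S ≃ₗ[ℂ] S') (ρ : Representation ℂ G S) : Representation ℂ G S' where
  toFun g := e.conj (ρ g)
  map_one' := by rw [map_one]; exact e.conj_id
  map_mul' g h := by rw [map_mul]; exact e.conj_comp _ _

variable {F : Type*} [Field F] [ValuativeRel F] [TopologicalSpace F]
  [IsNonarchimedeanLocalField F]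

/-- Left multiplication by an invertible matrix, as a homeomorphism. -/
def mulLeftHomeo {N : Type*} [Fintype N] [DecidableEq N] {K : Type*} (g : GL N F) :
    Matrix N K F ≃ₜ Matrix N K F where
  toFun x := (g : Matrix N N F) * x
  invFun x := ((g⁻¹ : GL N F) : Matrix N N F) * x
  left_inv x := by
    change ((g⁻¹ : GL N F) : Matrix N N F) * ((g : Matrix N N F) * x) = x
    rw [← Matrix.mul_assoc, ← Units.val_mul, inv_mul_cancel, Units.val_one, Matrix.one_mul]
  right_inv x := by
    change (g : Matrix N N F) * (((g⁻¹ : GL N F) : Matrix N N F) * x) = x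
    rw [← Matrix.mul_assoc, ← Units.val_mul, mul_inv_cancel, Units.val_one, Matrix.one_mul]
  continuous_toFun := continuous_const.matrix_mul continuous_id
  continuous_invFun := continuous_const.matrix_mul continuous_id

/-- Right multiplication by an invertible matrix, as a homeomorphism. -/
def mulRightHomeo {N : Type*} [Fintype N] [DecidableEq N] {K : Type*} (g : GL N F) :
    Matrix K N F ≃ₜ Matrix K N F where
  toFun y := y * (g : Matrix N N F)
  invFun y := y * ((g⁻¹ : GL N F) : Matrix N N F)
  left_inv y := by
    change y * (g : Matrix N N F) * ((g⁻¹ : GL N F) : Matrix N N F) = y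
    rw [Matrix.mul_assoc, ← Units.val_mul, mul_inv_cancel, Units.val_one, Matrix.mul_one]
  right_inv y := by
    change y * ((g⁻¹ : GL N F) : Matrix N N F) * (g : Matrix N N F) = y
    rw [Matrix.mul_assoc, ← Units.val_mul, inv_mul_cancel, Units.val_one, Matrix.mul_one]
  continuous_toFun := continuous_id.matrix_mul continuous_const
  continuous_invFun := continuous_id.matrix_mul continuous_const

variable (F) in
/-- The vector space `V ⊗ W⁺`, where `V` has dimension `2p` and `W` has dimension `2q`: matrices
whose `q` columns are vectors of `V`, written in the basis `e₁, …, e_p, e_{-p}, …, e_{-1}`. -/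
abbrev SpaceVWplus (p q : ℕ) : Type _ := Matrix (Fin p ⊕ Fin p) (Fin q) F

variable (F) in
/-- The vector space `V⁻ ⊗ W`, where `V` has dimension `2p` and `W` has dimension `2q`: matrices
whose `p` rows are vectors of `W`, written in the basis `f₁, …, f_q, f_{-q}, …, f_{-1}`. -/
abbrev SpaceVminusW (p q : ℕ) : Type _ := Matrix (Fin p) (Fin q ⊕ Fin q) F

/-- The linear action `(ω(h)φ)(x) = φ(h⁻¹x)` of `SO(V)` on `𝒮(V ⊗ W⁺)`. -/
def linearSO (p q : ℕ) : Representation ℂ (SO F p) (schwartzBruhat (SpaceVWplus F p q)) where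
  toFun h := (schwartzComp (mulLeftHomeo (h⁻¹ : GL (Fin p ⊕ Fin p) F))).toLinearMap
  map_one' := by
    refine LinearMap.ext fun φ => Subtype.ext (funext fun x => ?_)
    change φ.1 (((1 : GL (Fin p ⊕ Fin p) F)⁻¹ : GL _ F).1 * x) = φ.1 x
    rw [inv_one, Units.val_one, Matrix.one_mul]
  map_mul' h h' := by
    refine LinearMap.ext fun φ => Subtype.ext (funext fun x => ?_)
    change φ.1 (((h * h' : GL (Fin p ⊕ Fin p) F)⁻¹ : GL _ F).1 * x) =
      φ.1 ((h' : GL (Fin p ⊕ Fin p) F)⁻¹.1 * ((h : GL (Fin p ⊕ Fin p) F)⁻¹.1 * x))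
    rw [mul_inv_rev, Units.val_mul, Matrix.mul_assoc]

/-- The linear action `(ω(g)φ)(y) = φ(yg)` of `Sp(W)` on `𝒮(V⁻ ⊗ W)`. -/
def linearSp (p q : ℕ) : Representation ℂ (Sp F q) (schwartzBruhat (SpaceVminusW F p q)) where
  toFun g := (schwartzComp (mulRightHomeo (g : GL (Fin q ⊕ Fin q) F))).toLinearMap
  map_one' := by
    refine LinearMap.ext fun φ => Subtype.ext (funext fun y => ?_)
    change φ.1 (y * (1 : GL (Fin q ⊕ Fin q) F).1) = φ.1 y
    rw [Units.val_one, Matrix.mul_one]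
  map_mul' g g' := by
    refine LinearMap.ext fun φ => Subtype.ext (funext fun y => ?_)
    change φ.1 (y * (g * g' : GL (Fin q ⊕ Fin q) F).1) = φ.1 (y * g.1.1 * g'.1.1)
    rw [Units.val_mul, Matrix.mul_assoc]

/-- The decomposition `V ⊗ W⁺ = (V⁺ ⊗ W⁺) ⊕ (V⁻ ⊗ W⁺)`. -/
def rowsHomeo (p q : ℕ) :
    Matrix (Fin p) (Fin q) F × Matrix (Fin p) (Fin q) F ≃ₜ SpaceVWplus F p q where
  toFun z := Matrix.fromRows z.1 z.2
  invFun x := (x.toRows₁, x.toRows₂)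
  left_inv z := by simp
  right_inv x := by simp
  continuous_toFun := continuous_matrix fun i j => by
    rcases i with i | i
    · exact continuous_fst.matrix_elem i j
    · exact continuous_snd.matrix_elem i j
  continuous_invFun :=
    (continuous_matrix fun i j => continuous_id.matrix_elem (Sum.inl i) j).prodMk
      (continuous_matrix fun i j => continuous_id.matrix_elem (Sum.inr i) j)

/-- The decomposition `V⁻ ⊗ W = (V⁻ ⊗ W⁻) ⊕ (V⁻ ⊗ W⁺)`. The first summand is identified with the
dual of `V⁺ ⊗ W⁺` by means of the product of the forms on `V` and `W`, so that the coefficient of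
`e_{-i} ⊗ f_{-j}` is placed in position `(i, j)`. -/
def colsHomeo (p q : ℕ) :
    SpaceVminusW F p q ≃ₜ Matrix (Fin p) (Fin q) F × Matrix (Fin p) (Fin q) F where
  toFun y := (y.toCols₂.submatrix Fin.rev Fin.rev, y.toCols₁)
  invFun z := Matrix.fromCols z.2 (z.1.submatrix Fin.rev Fin.rev)
  left_inv y := by
    ext i j
    rcases j with j | j <;> simp
  right_inv z := by
    ext i j <;> simp
  continuous_toFun :=
    (continuous_matrix fun (i : Fin p) (j : Fin q) =>
      continuous_id.matrix_elem i.rev (Sum.inr j.rev)).prodMk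
      (continuous_matrix fun i j => continuous_id.matrix_elem i (Sum.inl j))
  continuous_invFun := continuous_matrix fun i j => by
    rcases j with j | j
    · exact continuous_snd.matrix_elem i j
    · exact continuous_fst.matrix_elem i.rev j.rev

variable {ψ : AddChar F Circle} (hψ : Continuous ψ) (hψ1 : ψ ≠ 1)

/-- The partial Fourier transform `𝒮(V ⊗ W⁺) ≃ 𝒮(V⁻ ⊗ W)` along `V⁺ ⊗ W⁺`, which sends `φ` to
`(a, b) ↦ ∫ φ(x, a) ψ⟨x, b⟩ dx`, with `x ∈ V⁺ ⊗ W⁺`, `a ∈ V⁻ ⊗ W⁺`, `b ∈ V⁻ ⊗ W⁻`. -/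
def mixedFourier (p q : ℕ) :
    schwartzBruhat (SpaceVWplus F p q) ≃ₗ[ℂ] schwartzBruhat (SpaceVminusW F p q) :=
  (schwartzComp (rowsHomeo p q)).trans
    ((partialFourier hψ hψ1).trans (schwartzComp (colsHomeo p q)))

theorem mixedFourier_apply (p q : ℕ) (φ : schwartzBruhat (SpaceVWplus F p q))
    (y : SpaceVminusW F p q) :
    (mixedFourier hψ hψ1 p q φ).1 y =
      haarIntegral fun x : Matrix (Fin p) (Fin q) F => φ.1 (Matrix.fromRows x y.toCols₁) *
        (ψ (∑ i, ∑ j, x i j * y i.rev (Sum.inr j.rev)) : ℂ) := rfl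

/-- The Weil representation of the dual pair `(SO_{2p}, Sp_{2q})` realized on `𝒮(V ⊗ W⁺)`:
the action of `SO(V)`.

In the model `𝒮(V ⊗ W⁺)` the group `SO(V)` acts linearly, in the model `𝒮(V⁻ ⊗ W)` the group `Sp(W)`
acts linearly, and the two models are identified by the partial Fourier transform along `V⁺ ⊗ W⁺`.
This determines both actions in both models, and the two actions commute. On the unipotent radical
of the Siegel parabolic subgroup of `Sp(W)` one gets in the first model
`(ω(n(X))φ)(x) = ψ(½ tr(Gr(x) X v)) φ(x)`, where `Gr` is the Gram matrix, and on that of `SO(V)` in the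
second model `(ω(n(X))φ)(y) = ψ(½ tr(Gr(y) v X)) φ(y)`. -/
def weilVWplusSO (p q : ℕ) : Representation ℂ (SO F p) (schwartzBruhat (SpaceVWplus F p q)) :=
  linearSO p q

/-- The Weil representation of the dual pair `(SO_{2p}, Sp_{2q})` realized on `𝒮(V ⊗ W⁺)`:
the action of `Sp(W)`. -/
def weilVWplusSp (p q : ℕ) : Representation ℂ (Sp F q) (schwartzBruhat (SpaceVWplus F p q)) :=
  transport (mixedFourier hψ hψ1 p q).symm (linearSp p q)

/-- The Weil representation of the dual pair `(SO_{2p}, Sp_{2q})` realized on `𝒮(V⁻ ⊗ W)`: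
the action of `SO(V)`. -/
def weilVminusWSO (p q : ℕ) : Representation ℂ (SO F p) (schwartzBruhat (SpaceVminusW F p q)) :=
  transport (mixedFourier hψ hψ1 p q) (linearSO p q)

/-- The Weil representation of the dual pair `(SO_{2p}, Sp_{2q})` realized on `𝒮(V⁻ ⊗ W)`:
the action of `Sp(W)`. -/
def weilVminusWSp (p q : ℕ) : Representation ℂ (Sp F q) (schwartzBruhat (SpaceVminusW F p q)) :=
  linearSp p q

/-- `Θ(1_W, V)` for `V` of dimension `2p` and `W` of dimension `2q`. -/
def thetaTrivialSp (p q : ℕ) :=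
  bigTheta (weilVminusWSO hψ hψ1 p q) (weilVminusWSp p q)

/-- `Θ(1_V, W)` for `V` of dimension `2p` and `W` of dimension `2q`. -/
def thetaTrivialSO (p q : ℕ) :=
  bigTheta (weilVWplusSp hψ hψ1 p q) (weilVWplusSO p q)

end Representations
end
end LocalTheta

/-! Both parts are instances of a see-saw argument. In part 1 write W = W₁ ⊕ W₂, so that V⁻ ⊗ W is
the product of V⁻ ⊗ W₁ and V⁻ ⊗ W₂. External products f ⊗ g span 𝒮(V⁻ ⊗ W), and on them Sp(W₁) ×
Sp(W₂) acts factor by factor, while SO(V) acts diagonally through the Weil representations of the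
two smaller dual pairs.

Let T : ω → σ ⊗ π be nonzero and let l be a nonzero functional on π invariant under Sp(W₁) × Sp(W₂).
The contraction L = (id ⊗ l) ∘ T : ω → σ is SO(V)-equivariant and does not see Sp(W₁) × Sp(W₂), so
(f, g) ↦ L(f ⊗ g) descends to the coinvariants in each variable. This is the required map from the
tensor product of the two big theta lifts to σ. It is nonzero: the translates of l separate the
vectors of the irreducible π, so L = 0 would force T = 0, and L is determined by its values on
external products. Part 2 is the same argument with the two groups exchanged and V = V₁ ⊕ V₂. The
formal part is `exists_intertwiningMap_bigTheta`.

The analytic input is that the action which is not linear in the chosen model also respects external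
products. It is defined by conjugation with the partial Fourier transform, and the transform of f ⊗
g is a scalar multiple of the external product of the transforms (`exists_mixedFourier_extProd`).
The scalar compares independently normalised Haar measures, and it disappears under conjugation
(`transport_bilinear`). Its existence is a form of Fubini, derived from uniqueness of
translation-invariant functionals on Schwartz–Bruhat functions (`exists_eq_mul_haarFunctional`).
That uniqueness and the spanning statement `span_extProd` both reduce to characteristic functions of
cosets of compact open subgroups. -/

namespace LocalTheta
noncomputable section

/-! ### The see-saw argument for abstract representations -/

section AbstractTheta

/-- A vector of an irreducible representation killed by all translates of a nonzero functional
is zero. -/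
theorem eq_zero_of_forall_translate_eq_zero {H V : Type*} [Group H] [AddCommGroup V] [Module ℂ V]
    {π : Representation ℂ H V} (hπ : π.IsIrreducible) {l : V →ₗ[ℂ] ℂ} (hl : l ≠ 0) {v : V}
    (hv : ∀ h, l (π h v) = 0) : v = 0 := by
  -- The vectors killed by every translate of `l` form a subrepresentation, and it is proper because
  -- the translate by 1 is `l` itself.
  let W : Subrepresentation π :=
    { toSubmodule :=
        { carrier := {v | ∀ h, l (π h v) = 0}
          add_mem' := fun hx hy h => by rw [map_add, map_add, hx h, hy h, add_zero]
          zero_mem' := fun h => by rw [map_zero, map_zero]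
          smul_mem' := fun c x hx h => by rw [map_smul, map_smul, hx h, smul_zero] }
      apply_mem_toSubmodule := fun g x hx h => by
        rw [← Module.End.mul_apply, ← map_mul]
        exact hx (h * g) }
  have hvW : v ∈ W.toSubmodule := hv
  rcases hπ.eq_bot_or_eq_top W with h | h
  · rw [h] at hvW
    exact hvW
  · refine absurd (LinearMap.ext fun x => ?_) hl
    have hx : x ∈ W.toSubmodule := by rw [h]; exact Submodule.mem_top
    simpa using hx 1

/-- Contraction of the second tensor factor with a functional. -/
def contractRight {U V : Type*} [AddCommGroup U] [Module ℂ U] [AddCommGroup V] [Module ℂ V]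
    (l : V →ₗ[ℂ] ℂ) : U ⊗[ℂ] V →ₗ[ℂ] U :=
  (TensorProduct.rid ℂ U).toLinearMap ∘ₗ TensorProduct.map LinearMap.id l

theorem contractRight_map_left {U V : Type*} [AddCommGroup U] [Module ℂ U] [AddCommGroup V]
    [Module ℂ V] (l : V →ₗ[ℂ] ℂ) (A : U →ₗ[ℂ] U) (t : U ⊗[ℂ] V) :
    contractRight l (TensorProduct.map A LinearMap.id t) = A (contractRight l t) := by
  induction t with
  | zero => simp
  | add x y hx hy => simp only [map_add, hx, hy]
  | tmul u v => simp [contractRight]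

theorem contractRight_map_right {U V : Type*} [AddCommGroup U] [Module ℂ U] [AddCommGroup V]
    [Module ℂ V] (l : V →ₗ[ℂ] ℂ) (A : V →ₗ[ℂ] V) (t : U ⊗[ℂ] V) :
    contractRight l (TensorProduct.map LinearMap.id A t) = contractRight (l ∘ₗ A) t := by
  induction t with
  | zero => simp
  | add x y hx hy => simp only [map_add, hx, hy]
  | tmul u v => simp [contractRight]

/-- A tensor killed by all translates of a nonzero functional on an irreducible second factor
is zero. -/
theorem tensor_eq_zero_of_contractRight {H U V : Type*} [Group H] [AddCommGroup U] [Module ℂ U]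
    [AddCommGroup V] [Module ℂ V] {π : Representation ℂ H V} (hπ : π.IsIrreducible)
    {l : V →ₗ[ℂ] ℂ} (hl : l ≠ 0) {t : U ⊗[ℂ] V}
    (ht : ∀ h, contractRight l (TensorProduct.map LinearMap.id (π h) t) = 0) : t = 0 := by
  classical
  -- Write t as a finite sum of b i ⊗ v i. Contracting with the translate of `l` by h gives the
  -- vector with coordinates l (π h (v i)), so each v i is killed by all translates. No finiteness
  -- of `U` is needed.
  let b := Module.Basis.ofVectorSpace ℂ U
  let e := TensorProduct.equivFinsuppOfBasisLeft (N := V) b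
  refine e.map_eq_zero_iff.1 (Finsupp.ext fun i => ?_)
  refine eq_zero_of_forall_translate_eq_zero hπ hl fun h => ?_
  have key : ∀ s : U ⊗[ℂ] V, l (π h (e s i)) = b.coord i (contractRight (l ∘ₗ π h) s) := by
    intro s
    induction s with
    | zero => simp
    | add x y hx hy => simp only [map_add, Finsupp.add_apply, hx, hy]
    | tmul u v => simp [e, contractRight, mul_comm]
  rw [key, ← contractRight_map_right, ht, map_zero]

variable {G H H₁ H₂ S S₁ S₂ U V : Type*} [Group G] [Group H] [Group H₁] [Group H₂]
  [AddCommGroup S] [Module ℂ S] [AddCommGroup S₁] [Module ℂ S₁] [AddCommGroup S₂] [Module ℂ S₂]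
  [AddCommGroup U] [Module ℂ U] [AddCommGroup V] [Module ℂ V]

/-- The see-saw lemma contracts the second tensor factor. In part 2 the invariant functional lives
on σ, the first factor, so the roles have to be exchanged. -/
theorem Corresponds.symm {ωG : Representation ℂ G S} {ωH : Representation ℂ H S}
    {σ : Representation ℂ G U} {π : Representation ℂ H V} (h : Corresponds ωG ωH σ π) :
    Corresponds ωH ωG π σ := by
  obtain ⟨T, hT, hG, hH⟩ := h
  have comm : ∀ (A : U →ₗ[ℂ] U) (B : V →ₗ[ℂ] V) (t : U ⊗[ℂ] V),
      TensorProduct.comm ℂ U V (TensorProduct.map A B t) =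
        TensorProduct.map B A (TensorProduct.comm ℂ U V t) := fun A B t => by
    induction t with
    | zero => simp
    | add x y hx hy => simp only [map_add, hx, hy]
    | tmul u v => simp
  refine ⟨(TensorProduct.comm ℂ U V).toLinearMap ∘ₗ T, fun h0 => hT ?_, fun g φ => ?_,
    fun g φ => ?_⟩
  · refine LinearMap.ext fun φ => (TensorProduct.comm ℂ U V).map_eq_zero_iff.1 ?_
    exact LinearMap.congr_fun h0 φ
  · simp [hH, comm]
  · simp [hG, comm]

/-- If a bilinear map `S₁ × S₂ → S` with spanning image intertwines the actions of `G` and of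
`H₁ × H₂`, a functional on `π` invariant under `H₁ × H₂` gives a nonzero intertwining map from the
tensor product of big theta lifts of trivial representations to any `σ` corresponding to `π`. -/
theorem exists_intertwiningMap_bigTheta {ωG : Representation ℂ G S} {ωH : Representation ℂ H S}
    {ωG₁ : Representation ℂ G S₁} {ωH₁ : Representation ℂ H₁ S₁}
    {ωG₂ : Representation ℂ G S₂} {ωH₂ : Representation ℂ H₂ S₂}
    (β : S₁ →ₗ[ℂ] S₂ →ₗ[ℂ] S) (hβ : Submodule.span ℂ {s | ∃ x y, s = β x y} = ⊤)
    (i : H₁ → H₂ → H) (hG : ∀ g x y, ωG g (β x y) = β (ωG₁ g x) (ωG₂ g y))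
    (hH : ∀ h₁ h₂ x y, ωH (i h₁ h₂) (β x y) = β (ωH₁ h₁ x) (ωH₂ h₂ y))
    {σ : Representation ℂ G U} {π : Representation ℂ H V} (hπ : π.IsIrreducible)
    {l : V →ₗ[ℂ] ℂ} (hl : l ≠ 0) (hli : ∀ h₁ h₂ v, l (π (i h₁ h₂) v) = l v)
    (hT : Corresponds ωG ωH σ π) :
    ∃ T : ((bigTheta ωG₁ ωH₁).tprod (bigTheta ωG₂ ωH₂)).IntertwiningMap σ, T ≠ 0 := by
  obtain ⟨T, hT0, hTG, hTH⟩ := hT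
  let L : S →ₗ[ℂ] U := contractRight l ∘ₗ T
  have hLG : ∀ g φ, L (ωG g φ) = σ g (L φ) := fun g φ => by
    change contractRight l (T _) = _
    rw [hTG, contractRight_map_left]
    rfl
  have hLH : ∀ h₁ h₂ φ, L (ωH (i h₁ h₂) φ) = L φ := fun h₁ h₂ φ => by
    change contractRight l (T _) = contractRight l (T _)
    rw [hTH, contractRight_map_right]
    congr 2
    exact LinearMap.ext fun v => hli h₁ h₂ v
  -- Equivariance of `T` under `H` turns the contraction of T φ by a translate of `l` into the value
  -- of `L` at a translate of φ.
  have hL0 : L ≠ 0 := fun h0 => hT0 <| LinearMap.ext fun φ =>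
    tensor_eq_zero_of_contractRight hπ hl fun h => by
      rw [← hTH]
      exact LinearMap.congr_fun h0 _
  have hB : ∀ h₁ h₂ x y, L (β (ωH₁ h₁ x) (ωH₂ h₂ y)) = L (β x y) := fun h₁ h₂ x y => by
    rw [← hH, hLH]
  let B : S₁ →ₗ[ℂ] S₂ →ₗ[ℂ] U := β.compr₂ L
  have hBG : ∀ g x y, B (ωG₁ g x) (ωG₂ g y) = σ g (B x y) := fun g x y => by
    change L _ = σ g (L _)
    rw [← hG, hLG]
  have k₁ : thetaKernel ωG₁ ωH₁ ≤ LinearMap.ker B := by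
    rw [thetaKernel, Submodule.span_le]
    rintro _ ⟨g, h, x, rfl⟩
    refine LinearMap.ext fun y => ?_
    -- The generators of `thetaKernel` carry a translation by g. Compensating with g⁻¹ in the other
    -- variable moves it out as σ g, so commutation of the `G`- and `H₁`-actions is not needed.
    have e := hBG g (ωH₁ h x - x) (ωG₂ g⁻¹ y)
    rw [← Module.End.mul_apply (ωG₂ g), ← map_mul, mul_inv_cancel, map_one,
      Module.End.one_apply] at e
    have e' := hB h 1 x (ωG₂ g⁻¹ y)
    rw [map_one, Module.End.one_apply] at e'
    rw [e, map_sub, LinearMap.sub_apply]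
    change σ g (L _ - L _) = 0
    rw [e', sub_self, map_zero]
  have k₂ : ∀ x, thetaKernel ωG₂ ωH₂ ≤ LinearMap.ker (B x) := fun x => by
    rw [thetaKernel, Submodule.span_le]
    rintro _ ⟨g, h, y, rfl⟩
    change B x _ = 0
    have e := hBG g (ωG₁ g⁻¹ x) (ωH₂ h y - y)
    rw [← Module.End.mul_apply (ωG₁ g), ← map_mul, mul_inv_cancel, map_one,
      Module.End.one_apply] at e
    have e' := hB 1 h (ωG₁ g⁻¹ x) y
    rw [map_one, Module.End.one_apply] at e'
    rw [e, map_sub]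
    change σ g (L _ - L _) = 0
    rw [e', sub_self, map_zero]
  -- Descend in the second variable for each fixed x, then in the first.
  let B' : (S₁ ⧸ thetaKernel ωG₁ ωH₁) →ₗ[ℂ] (S₂ ⧸ thetaKernel ωG₂ ωH₂) →ₗ[ℂ] U :=
    Submodule.liftQ _
      { toFun := fun x => Submodule.liftQ _ (B x) (k₂ x)
        map_add' := fun x x' => by
          ext y
          simp
        map_smul' := fun c x => by
          ext y
          simp }
      (fun x hx => by
        have hx' : B x = 0 := k₁ hx
        refine LinearMap.mem_ker.2 (Submodule.linearMap_qext _ (LinearMap.ext fun y => ?_))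
        change B x y = 0
        rw [hx']
        rfl)
  refine ⟨{ toLinearMap := TensorProduct.lift B', isIntertwining' := fun g => ?_ }, fun h0 => ?_⟩
  · refine TensorProduct.ext' fun x y => ?_
    obtain ⟨x, rfl⟩ := Submodule.Quotient.mk_surjective _ x
    obtain ⟨y, rfl⟩ := Submodule.Quotient.mk_surjective _ y
    exact hBG g x y
  · apply hL0
    -- The descended map sends the class of x ⊗ y to L (β x y), and the vectors β x y span `S`. Its
    -- vanishing would therefore give L = 0.
    rw [← LinearMap.ker_eq_top, eq_top_iff, ← hβ, Submodule.span_le]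
    rintro _ ⟨x, y, rfl⟩
    have h1 := congrArg (fun T => T.toLinearMap
      (Submodule.Quotient.mk x ⊗ₜ[ℂ] Submodule.Quotient.mk y)) h0
    exact h1

end AbstractTheta
-- Schwartz–Bruhat functions and cosets of compact open subgroups
section Cosets

/-- In a nonarchimedean locally compact group every neighbourhood of zero contains a compact open
subgroup. -/
theorem exists_compact_open_addSubgroup {E : Type*} [AddCommGroup E] [TopologicalSpace E]
    [NonarchimedeanAddGroup E] [LocallyCompactSpace E] {U : Set E} (hU : U ∈ nhds 0) :
    ∃ K : AddSubgroup E, IsOpen (K : Set E) ∧ IsCompact (K : Set E) ∧ (K : Set E) ⊆ U := by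
  obtain ⟨C, hC, hCU, hCc⟩ := local_compact_nhds hU
  obtain ⟨K, hK⟩ := NonarchimedeanAddGroup.is_nonarchimedean C hC
  exact ⟨K.toAddSubgroup, K.isOpen', hCc.of_isClosed_subset K.isClosed hK, hK.trans hCU⟩

/-- A Schwartz--Bruhat function is invariant under a compact open subgroup. -/
theorem exists_invariant {E : Type*} [AddCommGroup E] [TopologicalSpace E]
    [NonarchimedeanAddGroup E] [LocallyCompactSpace E] {f : E → ℂ} (hf : f ∈ schwartzBruhat E) :
    ∃ K : AddSubgroup E, IsOpen (K : Set E) ∧ IsCompact (K : Set E) ∧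
      ∀ x, ∀ u ∈ K, f (x + u) = f x := by
  obtain ⟨hl, hs⟩ := hf
  -- `K₀` is arbitrary and serves only the empty set in the compactness induction on the support.
  obtain ⟨K₀, hK₀, hK₀c, -⟩ := exists_compact_open_addSubgroup (E := E) Filter.univ_mem
  obtain ⟨K, hK, hKc, h⟩ := hs.isCompact.induction_on (p := fun s => ∃ K : AddSubgroup E,
      IsOpen (K : Set E) ∧ IsCompact (K : Set E) ∧ ∀ x ∈ s, ∀ u ∈ K, f (x + u) = f x)
    ⟨K₀, hK₀, hK₀c, by simp⟩
    (fun s t hst ⟨K, hK, hKc, h⟩ => ⟨K, hK, hKc, fun x hx => h x (hst hx)⟩)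
    (fun s t ⟨K, hK, hKc, h⟩ ⟨K', hK', hKc', h'⟩ =>
      ⟨K ⊓ K', hK.inter hK', hKc.inter_right (AddSubgroup.isClosed_of_isOpen _ hK'),
        fun x hx u hu => hx.elim (fun hx => h x hx u hu.1) (fun hx => h' x hx u hu.2)⟩)
    (fun z _ => by
      have hz : {y | f (z + y) = f z} ∈ nhds (0 : E) := by
        have h4 : Filter.Tendsto (fun y => z + y) (nhds 0) (nhds z) := by
          have : Continuous fun y => z + y := by fun_prop
          simpa using this.tendsto 0
        exact h4.eventually (hl.eventually_eq z)
      obtain ⟨K, hK, hKc, h⟩ := exists_compact_open_addSubgroup hz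
      have key : ∀ u ∈ K, f (z + u) = f z := fun u hu => h hu
      -- Since `K` is a subgroup, constancy of f on z + K gives invariance at every point of that
      -- coset, not only at z.
      refine ⟨{y | y - z ∈ K}, mem_nhdsWithin_of_mem_nhds (IsOpen.mem_nhds
        (hK.preimage (continuous_id.sub continuous_const)) ?_), K, hK, hKc, fun y hy u hu => ?_⟩
      · change z - z ∈ K
        rw [sub_self]
        exact K.zero_mem
      · have e1 := key _ (K.add_mem hy hu)
        have e2 := key _ hy
        rw [← add_assoc, add_sub_cancel] at e1
        rw [add_sub_cancel] at e2
        rw [e1, e2])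
  refine ⟨K, hK, hKc, fun x u hu => ?_⟩
  -- Invariance is known at points of the support. If only x + u lies there, translate back by −u;
  -- if neither point does, both values vanish.
  by_cases h3 : x ∈ tsupport f
  · exact h x h3 u hu
  by_cases h4 : x + u ∈ tsupport f
  · have h5 := h _ h4 (-u) (K.neg_mem hu)
    rw [add_neg_cancel_right] at h5
    exact h5.symm
  · rw [image_eq_zero_of_notMem_tsupport h3, image_eq_zero_of_notMem_tsupport h4]

variable {E : Type*} [AddCommGroup E] [TopologicalSpace E] [IsTopologicalAddGroup E]

open Classical in
/-- The characteristic function of the coset `z + K` of a compact open subgroup. -/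
def cosetIndicator (K : AddSubgroup E) (ho : IsOpen (K : Set E)) (hc : IsCompact (K : Set E))
    (z : E) : schwartzBruhat E :=
  ⟨fun x => if x - z ∈ K then 1 else 0, by
    have hcl : IsClosed {x : E | x - z ∈ K} :=
      (AddSubgroup.isClosed_of_isOpen _ ho).preimage (continuous_id.sub continuous_const)
    constructor
    · rw [IsLocallyConstant.iff_eventually_eq]
      intro x
      have hopen : IsOpen {y : E | y - x ∈ K} :=
        ho.preimage (continuous_id.sub continuous_const)
      filter_upwards [hopen.mem_nhds (by change x - x ∈ K; rw [sub_self]; exact K.zero_mem)]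
        with y hy
      have : y - z ∈ K ↔ x - z ∈ K := by
        rw [← sub_add_sub_cancel y x z]
        exact K.add_mem_cancel_left hy
      simp only [this]
    · refine HasCompactSupport.intro' (K := {x : E | x - z ∈ K}) ?_ hcl fun x hx => if_neg hx
      have : {x : E | x - z ∈ K} = (fun x => x + z) '' (K : Set E) := by
        ext x
        simp [sub_eq_add_neg]
      rw [this]
      exact hc.image (continuous_id.add continuous_const)⟩

open Classical in
theorem cosetIndicator_apply {K : AddSubgroup E} {ho : IsOpen (K : Set E)}
    {hc : IsCompact (K : Set E)} {z x : E} :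
    (cosetIndicator K ho hc z).1 x = if x - z ∈ K then 1 else 0 := rfl

/-- A Schwartz--Bruhat function invariant under a compact open subgroup is a linear combination of
characteristic functions of cosets. -/
theorem mem_span_cosetIndicator {K : AddSubgroup E} (ho : IsOpen (K : Set E))
    (hc : IsCompact (K : Set E)) (f : schwartzBruhat E)
    (hf : ∀ x, ∀ u ∈ K, f.1 (x + u) = f.1 x) :
    f ∈ Submodule.span ℂ (Set.range (cosetIndicator K ho hc)) := by
  classical
  have hd : DiscreteTopology (E ⧸ K) := QuotientAddGroup.discreteTopology ho
  -- The quotient by an open subgroup is discrete, so the compact support meets only finitely many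
  -- cosets.
  have hfin : ((QuotientAddGroup.mk : E → E ⧸ K) '' tsupport f.1).Finite :=
    (f.2.2.isCompact.image QuotientAddGroup.continuous_mk).finite_of_discrete
  have hout : ∀ x : E, ∃ u ∈ K, x = (QuotientAddGroup.mk x : E ⧸ K).out + u := fun x => by
    obtain ⟨u, hu⟩ := QuotientAddGroup.mk_out_eq_add K x
    exact ⟨-u, K.neg_mem u.2, by rw [hu]; simp⟩
  have heq : f = ∑ q ∈ hfin.toFinset, f.1 q.out • cosetIndicator K ho hc q.out := by
    refine Subtype.ext (funext fun x => ?_)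
    obtain ⟨u, hu, hx⟩ := hout x
    have hsum : (∑ q ∈ hfin.toFinset, f.1 q.out • cosetIndicator K ho hc q.out).1 x =
        ∑ q ∈ hfin.toFinset, f.1 q.out * (if x - q.out ∈ K then 1 else 0) := by
      rw [AddSubmonoidClass.coe_finsetSum, Finset.sum_apply]
      rfl
    have hiff : ∀ q : E ⧸ K, x - q.out ∈ K ↔ q = QuotientAddGroup.mk x := fun q => by
      rw [← q.out_eq', QuotientAddGroup.eq, neg_add_eq_sub]
      simp
    simp only [hsum, hiff, mul_ite, mul_one, mul_zero, Finset.sum_ite_eq', Set.Finite.mem_toFinset]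
    have hfx : f.1 x = f.1 (QuotientAddGroup.mk x : E ⧸ K).out := by
      conv_lhs => rw [hx]
      exact hf _ u hu
    split_ifs with hmem
    · exact hfx
    · exact image_eq_zero_of_notMem_tsupport fun h => hmem ⟨x, h, rfl⟩
  rw [heq]
  exact Submodule.sum_mem _ fun q _ => Submodule.smul_mem _ _ (Submodule.subset_span ⟨_, rfl⟩)

end Cosets

/-! ### Uniqueness of translation-invariant functionals -/

section HaarUniqueness

/-- Integration against a Haar measure as a functional on Schwartz--Bruhat functions. -/
def haarFunctional (E : Type*) [AddCommGroup E] [TopologicalSpace E] [IsTopologicalAddGroup E]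
    [LocallyCompactSpace E] : schwartzBruhat E →ₗ[ℂ] ℂ where
  toFun f := haarIntegral f.1
  map_add' f g := haarIntegral_add f.2.1.continuous f.2.2 g.2.1.continuous g.2.2
  map_smul' c f := haarIntegral_const_mul c f.1

/-- Translation of Schwartz--Bruhat functions. -/
def schwartzTranslate {E : Type*} [AddCommGroup E] [TopologicalSpace E] [IsTopologicalAddGroup E]
    (u : E) : schwartzBruhat E ≃ₗ[ℂ] schwartzBruhat E :=
  schwartzComp (Homeomorph.addRight u)

theorem haarFunctional_cosetIndicator_ne_zero {E : Type*} [AddCommGroup E] [TopologicalSpace E]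
    [IsTopologicalAddGroup E] [LocallyCompactSpace E] {K : AddSubgroup E}
    (ho : IsOpen (K : Set E)) (hc : IsCompact (K : Set E)) :
    haarFunctional E (cosetIndicator K ho hc 0) ≠ 0 := by
  classical
  have h := haarIntegral_subgroup_ne_zero K ho hc
  have e : (cosetIndicator K ho hc 0).1 = (K : Set E).indicator fun _ => (1 : ℂ) := by
    funext x
    simp [cosetIndicator_apply, Set.indicator_apply]
  change haarIntegral _ ≠ 0
  rwa [e]

/-- The `K`-invariant functions are spanned by translates of the characteristic function of `K`, so
an invariant functional is determined on them by one value. The cross-multiplied form requires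
neither value to be nonzero. -/
theorem translationInvariant_proportional {E : Type*} [AddCommGroup E] [TopologicalSpace E]
    [IsTopologicalAddGroup E] {Λ Λ' : schwartzBruhat E →ₗ[ℂ] ℂ}
    (h : ∀ u f, Λ (schwartzTranslate u f) = Λ f) (h' : ∀ u f, Λ' (schwartzTranslate u f) = Λ' f)
    {K : AddSubgroup E} (ho : IsOpen (K : Set E)) (hc : IsCompact (K : Set E))
    (f : schwartzBruhat E) (hf : ∀ x, ∀ u ∈ K, f.1 (x + u) = f.1 x) :
    Λ f * Λ' (cosetIndicator K ho hc 0) = Λ' f * Λ (cosetIndicator K ho hc 0) := by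
  classical
  have hz : ∀ z, cosetIndicator K ho hc z = schwartzTranslate (-z) (cosetIndicator K ho hc 0) :=
    fun z => Subtype.ext (funext fun x => by
      change (cosetIndicator K ho hc z).1 x = (cosetIndicator K ho hc 0).1 (x + -z)
      simp only [cosetIndicator_apply, sub_zero, ← sub_eq_add_neg])
  refine Submodule.span_induction (p := fun f _ => Λ f * Λ' (cosetIndicator K ho hc 0) =
    Λ' f * Λ (cosetIndicator K ho hc 0)) ?_ ?_ ?_ ?_ (mem_span_cosetIndicator ho hc f hf)
  · rintro _ ⟨z, rfl⟩
    rw [hz, h, h', mul_comm]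
  · simp
  · intro f g _ _ hf hg
    rw [map_add, map_add, add_mul, add_mul, hf, hg]
  · intro c f _ hf
    rw [map_smul, map_smul, smul_mul_assoc, smul_mul_assoc, hf]

/-- Uniqueness of translation-invariant functionals on Schwartz--Bruhat functions. -/
theorem exists_eq_mul_haarFunctional {E : Type*} [AddCommGroup E] [TopologicalSpace E]
    [NonarchimedeanAddGroup E] [LocallyCompactSpace E] {Λ : schwartzBruhat E →ₗ[ℂ] ℂ}
    (h : ∀ u f, Λ (schwartzTranslate u f) = Λ f) :
    ∃ C : ℂ, ∀ f, Λ f = C * haarFunctional E f := by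
  classical
  have h' : ∀ u f, haarFunctional E (schwartzTranslate u f) = haarFunctional E f := fun u f =>
    haarIntegral_translate f.1 u
  obtain ⟨K₀, ho₀, hc₀, -⟩ := exists_compact_open_addSubgroup (E := E) Filter.univ_mem
  -- The constant is read off at a fixed `K₀`. An arbitrary f is invariant under some `K₁`, and both
  -- f and the characteristic function of `K₀` are invariant under K₀ ⊓ K₁, where the two
  -- functionals can be compared.
  refine ⟨Λ (cosetIndicator K₀ ho₀ hc₀ 0) / haarFunctional E (cosetIndicator K₀ ho₀ hc₀ 0),
    fun f => ?_⟩
  obtain ⟨K₁, ho₁, hc₁, hf⟩ := exists_invariant f.2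
  have ho : IsOpen ((K₀ ⊓ K₁ : AddSubgroup E) : Set E) := ho₀.inter ho₁
  have hc : IsCompact ((K₀ ⊓ K₁ : AddSubgroup E) : Set E) :=
    hc₀.inter_right (AddSubgroup.isClosed_of_isOpen _ ho₁)
  have e₁ := translationInvariant_proportional h h' ho hc f fun x u hu => hf x u hu.2
  have e₂ := translationInvariant_proportional h h' ho hc (cosetIndicator K₀ ho₀ hc₀ 0)
    fun x u hu => by
      have : x + u ∈ K₀ ↔ x ∈ K₀ := K₀.add_mem_cancel_right hu.1
      simp only [cosetIndicator_apply, sub_zero, this]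
  have n₀ := haarFunctional_cosetIndicator_ne_zero ho₀ hc₀
  have n := haarFunctional_cosetIndicator_ne_zero ho hc
  refine mul_right_cancel₀ n ?_
  rw [e₁]
  field_simp
  linear_combination (-haarFunctional E f) * e₂

end HaarUniqueness

/-! ### External products and their Haar integrals -/

section ExternalProduct

variable {X X₁ X₂ : Type*} [TopologicalSpace X] [TopologicalSpace X₁] [TopologicalSpace X₂]

/-- The external product of Schwartz--Bruhat functions along a decomposition `X ≃ X₁ × X₂`. -/
def extProd (s : X ≃ₜ X₁ × X₂) :
    schwartzBruhat X₁ →ₗ[ℂ] schwartzBruhat X₂ →ₗ[ℂ] schwartzBruhat X :=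
  LinearMap.mk₂ ℂ
    (fun f g => schwartzComp s ⟨fun z => f.1 z.1 * g.1 z.2,
      (f.2.1.comp_continuous continuous_fst).mul (g.2.1.comp_continuous continuous_snd), by
        refine HasCompactSupport.intro' (K := tsupport f.1 ×ˢ tsupport g.1)
          (f.2.2.isCompact.prod g.2.2.isCompact)
          ((isClosed_tsupport _).prod (isClosed_tsupport _)) fun z hz => ?_
        by_contra h
        exact hz ⟨subset_tsupport _ (left_ne_zero_of_mul h),
          subset_tsupport _ (right_ne_zero_of_mul h)⟩⟩)
    (fun _ _ _ => Subtype.ext (funext fun _ => add_mul _ _ _))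
    (fun _ _ _ => Subtype.ext (funext fun _ => mul_assoc _ _ _))
    (fun _ _ _ => Subtype.ext (funext fun _ => mul_add _ _ _))
    (fun _ _ _ => Subtype.ext (funext fun _ => mul_left_comm _ _ _))

theorem extProd_apply (s : X ≃ₜ X₁ × X₂) (f : schwartzBruhat X₁) (g : schwartzBruhat X₂) (x : X) :
    (extProd s f g).1 x = f.1 (s x).1 * g.1 (s x).2 := rfl

/-- A Schwartz–Bruhat function on E₁ × E₂ is invariant under some K₁ × K₂ with both factors compact
open, and the characteristic function of a coset of K₁ × K₂ is an external product. -/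
theorem span_extProd {E₁ E₂ : Type*} [AddCommGroup E₁] [TopologicalSpace E₁]
    [NonarchimedeanAddGroup E₁] [LocallyCompactSpace E₁] [AddCommGroup E₂] [TopologicalSpace E₂]
    [NonarchimedeanAddGroup E₂] [LocallyCompactSpace E₂] (s : X ≃ₜ E₁ × E₂) :
    Submodule.span ℂ {φ | ∃ f g, φ = extProd s f g} = ⊤ := by
  classical
  rw [eq_top_iff]
  intro φ _
  obtain ⟨φ, rfl⟩ := (schwartzComp s).surjective φ
  obtain ⟨K, ho, hc, hφ⟩ := exists_invariant φ.2
  obtain ⟨U₁, hU₁, U₂, hU₂, hU⟩ := mem_nhds_prod_iff.1 (ho.mem_nhds K.zero_mem)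
  obtain ⟨K₁, ho₁, hc₁, hK₁⟩ := exists_compact_open_addSubgroup hU₁
  obtain ⟨K₂, ho₂, hc₂, hK₂⟩ := exists_compact_open_addSubgroup hU₂
  have hop : IsOpen ((K₁.prod K₂ : AddSubgroup (E₁ × E₂)) : Set (E₁ × E₂)) := ho₁.prod ho₂
  have hcp : IsCompact ((K₁.prod K₂ : AddSubgroup (E₁ × E₂)) : Set (E₁ × E₂)) := hc₁.prod hc₂
  refine Submodule.span_induction (p := fun φ _ => schwartzComp s φ ∈
    Submodule.span ℂ {φ | ∃ f g, φ = extProd s f g}) ?_ ?_ ?_ ?_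
    (mem_span_cosetIndicator hop hcp φ fun x u hu => hφ x u (hU ⟨hK₁ hu.1, hK₂ hu.2⟩))
  · rintro _ ⟨z, rfl⟩
    refine Submodule.subset_span ⟨cosetIndicator K₁ ho₁ hc₁ z.1, cosetIndicator K₂ ho₂ hc₂ z.2,
      Subtype.ext (funext fun x => ?_)⟩
    change (cosetIndicator (K₁.prod K₂) hop hcp z).1 (s x) = _
    rw [extProd_apply, cosetIndicator_apply, cosetIndicator_apply, cosetIndicator_apply,
      ite_zero_mul_ite_zero, one_mul]
    exact if_congr Iff.rfl rfl rfl
  · rw [map_zero]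
    exact Submodule.zero_mem _
  · intro f g _ _ hf hg
    rw [map_add]
    exact Submodule.add_mem _ hf hg
  · intro c f _ hf
    rw [map_smul]
    exact Submodule.smul_mem _ _ hf

/-- The Haar integral of an external product is, up to a nonzero constant, the product of the
Haar integrals. -/
theorem exists_haarFunctional_extProd {E E₁ E₂ : Type*} [AddCommGroup E] [TopologicalSpace E]
    [IsTopologicalAddGroup E] [LocallyCompactSpace E] [AddCommGroup E₁] [TopologicalSpace E₁]
    [NonarchimedeanAddGroup E₁] [LocallyCompactSpace E₁] [AddCommGroup E₂] [TopologicalSpace E₂]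
    [NonarchimedeanAddGroup E₂] [LocallyCompactSpace E₂] (s : E ≃ₜ E₁ × E₂)
    (hs : ∀ x y, s (x + y) = s x + s y) :
    ∃ C : ℂ, C ≠ 0 ∧ ∀ f g, haarFunctional E (extProd s f g) =
      C * (haarFunctional E₁ f * haarFunctional E₂ g) := by
  classical
  have htr : ∀ u₁ u₂ f g, extProd s (schwartzTranslate u₁ f) (schwartzTranslate u₂ g) =
      schwartzTranslate (s.symm (u₁, u₂)) (extProd s f g) := fun u₁ u₂ f g =>
    Subtype.ext (funext fun x => by
      change f.1 ((s x).1 + u₁) * g.1 ((s x).2 + u₂) =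
        f.1 (s (x + s.symm (u₁, u₂))).1 * g.1 (s (x + s.symm (u₁, u₂))).2
      rw [hs, s.apply_symm_apply]
      rfl)
  have hinv : ∀ u f, haarFunctional E (schwartzTranslate u f) = haarFunctional E f := fun u f =>
    haarIntegral_translate f.1 u
  have tr0₁ : ∀ f : schwartzBruhat E₁, schwartzTranslate 0 f = f := fun f =>
    Subtype.ext (funext fun x => congrArg f.1 (add_zero x))
  have tr0₂ : ∀ f : schwartzBruhat E₂, schwartzTranslate 0 f = f := fun f =>
    Subtype.ext (funext fun x => congrArg f.1 (add_zero x))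
  -- With one factor fixed, the integral of the external product is translation-invariant in the
  -- other (`htr` with translation by 0 in the fixed factor), hence a multiple of its Haar integral.
  have h₁ : ∀ g, ∃ C : ℂ, ∀ f, haarFunctional E (extProd s f g) = C * haarFunctional E₁ f :=
    fun g => exists_eq_mul_haarFunctional (Λ := haarFunctional E ∘ₗ (extProd s).flip g)
      fun u f => by
        change haarFunctional E (extProd s _ g) = haarFunctional E (extProd s f g)
        conv_lhs => rw [← tr0₂ g]
        rw [htr, hinv]
  have h₂ : ∀ f, ∃ C : ℂ, ∀ g, haarFunctional E (extProd s f g) = C * haarFunctional E₂ g :=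
    fun f => exists_eq_mul_haarFunctional (Λ := haarFunctional E ∘ₗ extProd s f)
      fun u g => by
        change haarFunctional E (extProd s f _) = haarFunctional E (extProd s f g)
        conv_lhs => rw [← tr0₁ f]
        rw [htr, hinv]
  obtain ⟨K₁, ho₁, hc₁, -⟩ := exists_compact_open_addSubgroup (E := E₁) Filter.univ_mem
  obtain ⟨K₂, ho₂, hc₂, -⟩ := exists_compact_open_addSubgroup (E := E₂) Filter.univ_mem
  have n₁ := haarFunctional_cosetIndicator_ne_zero ho₁ hc₁
  have n : haarFunctional E (extProd s (cosetIndicator K₁ ho₁ hc₁ 0)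
      (cosetIndicator K₂ ho₂ hc₂ 0)) ≠ 0 := by
    -- The external product of the characteristic functions of `K₁` and `K₂` is that of the compact
    -- open subgroup of `E` corresponding to K₁ × K₂, so its integral is not zero.
    let K : AddSubgroup E := (K₁.prod K₂).comap (AddMonoidHom.mk' s hs)
    have hK : (K : Set E) = s ⁻¹' ((K₁ : Set E₁) ×ˢ (K₂ : Set E₂)) := rfl
    have ho : IsOpen (K : Set E) := by
      rw [hK]
      exact (ho₁.prod ho₂).preimage s.continuous
    have hc : IsCompact (K : Set E) := by
      rw [hK]
      exact s.isCompact_preimage.2 (hc₁.prod hc₂)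
    have e : extProd s (cosetIndicator K₁ ho₁ hc₁ 0) (cosetIndicator K₂ ho₂ hc₂ 0) =
        cosetIndicator K ho hc 0 := Subtype.ext (funext fun x => by
      rw [extProd_apply, cosetIndicator_apply, cosetIndicator_apply, cosetIndicator_apply,
        ite_zero_mul_ite_zero, one_mul, sub_zero, sub_zero, sub_zero]
      exact if_congr Iff.rfl rfl rfl)
    rw [e]
    exact haarFunctional_cosetIndicator_ne_zero ho hc
  set f₀ := cosetIndicator K₁ ho₁ hc₁ 0
  set g₀ := cosetIndicator K₂ ho₂ hc₂ 0
  obtain ⟨B, hB⟩ := h₂ f₀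
  -- Evaluating the integral of f₀ ⊗ g both ways identifies the constant `A` attached to g as B ∫g /
  -- ∫f₀.
  refine ⟨B / haarFunctional E₁ f₀, div_ne_zero (fun h0 => n ?_) n₁, fun f g => ?_⟩
  · rw [hB, h0, zero_mul]
  · obtain ⟨A, hA⟩ := h₁ g
    have e := hB g
    rw [hA f₀] at e
    rw [hA f]
    field_simp
    linear_combination (haarFunctional E₁ f) * e

end ExternalProduct
-- Splitting matrices along blocks of rows or columns
section Split
variable {F : Type*} [TopologicalSpace F]

/-- Splitting the rows of a matrix along a decomposition of the index set. -/
def splitRows {α β γ : Type*} (κ : Type*) (e : α ⊕ β ≃ γ) :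
    Matrix γ κ F ≃ₜ Matrix α κ F × Matrix β κ F where
  toFun x := (x.submatrix (fun i => e (Sum.inl i)) id, x.submatrix (fun i => e (Sum.inr i)) id)
  invFun z := (Matrix.fromRows z.1 z.2).submatrix e.symm id
  left_inv x := by
    ext i j
    obtain ⟨i | i, rfl⟩ := e.surjective i <;> simp
  right_inv z := by
    ext i j <;> simp
  continuous_toFun :=
    (continuous_matrix fun i j => continuous_id.matrix_elem (e (Sum.inl i)) j).prodMk
      (continuous_matrix fun i j => continuous_id.matrix_elem (e (Sum.inr i)) j)
  continuous_invFun := continuous_matrix fun i j => by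
    obtain ⟨i | i, rfl⟩ := e.surjective i
    · simpa using continuous_fst.matrix_elem i j
    · simpa using continuous_snd.matrix_elem i j

/-- Splitting the columns of a matrix along a decomposition of the index set. -/
def splitCols {α β γ : Type*} (κ : Type*) (e : α ⊕ β ≃ γ) :
    Matrix κ γ F ≃ₜ Matrix κ α F × Matrix κ β F where
  toFun x := (x.submatrix id (fun i => e (Sum.inl i)), x.submatrix id (fun i => e (Sum.inr i)))
  invFun z := (Matrix.fromCols z.1 z.2).submatrix id e.symm
  left_inv x := by
    ext j i
    obtain ⟨i | i, rfl⟩ := e.surjective i <;> simp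
  right_inv z := by
    ext j i <;> simp
  continuous_toFun :=
    (continuous_matrix fun i j => continuous_id.matrix_elem i (e (Sum.inl j))).prodMk
      (continuous_matrix fun i j => continuous_id.matrix_elem i (e (Sum.inr j)))
  continuous_invFun := continuous_matrix fun j i => by
    obtain ⟨i | i, rfl⟩ := e.surjective i
    · simpa using continuous_fst.matrix_elem j i
    · simpa using continuous_snd.matrix_elem j i

theorem splitRows_apply {α β γ κ : Type*} (e : α ⊕ β ≃ γ) (x : Matrix γ κ F) :
    splitRows κ e x = (x.submatrix (fun i => e (Sum.inl i)) id,
      x.submatrix (fun i => e (Sum.inr i)) id) := rfl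

theorem splitCols_apply {α β γ κ : Type*} (e : α ⊕ β ≃ γ) (x : Matrix κ γ F) :
    splitCols κ e x = (x.submatrix id (fun i => e (Sum.inl i)),
      x.submatrix id (fun i => e (Sum.inr i))) := rfl

theorem splitRows_blockDiagonal_mul [Field F] {α β γ κ : Type*} [Fintype α] [Fintype β]
    [Fintype γ] (e : α ⊕ β ≃ γ) (g₁ : Matrix α α F) (g₂ : Matrix β β F) (x : Matrix γ κ F) :
    splitRows κ e (Matrix.reindex e e (Matrix.fromBlocks g₁ 0 0 g₂) * x) =
      (g₁ * (splitRows κ e x).1, g₂ * (splitRows κ e x).2) := by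
  ext i j <;> simp [splitRows_apply, Matrix.mul_apply, ← e.sum_comp]

theorem splitCols_mul_blockDiagonal [Field F] {α β γ κ : Type*} [Fintype α] [Fintype β]
    [Fintype γ] (e : α ⊕ β ≃ γ) (g₁ : Matrix α α F) (g₂ : Matrix β β F) (x : Matrix κ γ F) :
    splitCols κ e (x * Matrix.reindex e e (Matrix.fromBlocks g₁ 0 0 g₂)) =
      ((splitCols κ e x).1 * g₁, (splitCols κ e x).2 * g₂) := by
  ext i j <;> simp [splitCols_apply, Matrix.mul_apply, ← e.sum_comp]

end Split

/-! ### Matrix spaces over the local field -/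

section Matrices
variable {F : Type*} [Field F] [ValuativeRel F] [TopologicalSpace F]
  [IsNonarchimedeanLocalField F]

instance {ι κ : Type*} [Fintype ι] [Fintype κ] : NonarchimedeanAddGroup (Matrix ι κ F) where
  is_nonarchimedean U hU := by
    obtain ⟨c, hc, h⟩ := exists_ball_subset hU
    exact ⟨⟨ball ι κ c, isOpen_ball hc⟩, h⟩

/-- The character is trivial on the ball given by its conductor, hence constant on translates of
that ball. This makes the integrand of the partial Fourier transform a Schwartz–Bruhat function. -/
theorem isLocallyConstant_addChar {ψ : AddChar F Circle} (hψ : Continuous ψ) (hψ1 : ψ ≠ 1) :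
    IsLocallyConstant ψ := by
  obtain ⟨d, hd, h⟩ := exists_conductor hψ hψ1
  have hker : ∀ u, valuation F u ≤ valuation F d → ψ u = 1 := fun u hu => by
    simpa using (h u).2 hu 1 (by simp)
  rw [IsLocallyConstant.iff_eventually_eq]
  intro x
  have hopen : IsOpen {y : F | valuation F (y - x) ≤ valuation F d} :=
    (isOpen_closedBall hd).preimage (continuous_id.sub continuous_const)
  filter_upwards [hopen.mem_nhds (by simp)] with y hy
  have e : y = (y - x) + x := by ring
  rw [e, AddChar.map_add_eq_mul, hker _ hy, one_mul]

end Matrices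

/-! ### The partial Fourier transform of an external product -/

section FourierExtProd
variable {F : Type*} [Field F] [ValuativeRel F] [TopologicalSpace F]
  [IsNonarchimedeanLocalField F] {ψ : AddChar F Circle} (hψ : Continuous ψ) (hψ1 : ψ ≠ 1)

/-- The integrand in the partial Fourier transform of `φ` at `y`, as a Schwartz--Bruhat
function. -/
def mixedFourierIntegrand (p q : ℕ) (φ : schwartzBruhat (SpaceVWplus F p q))
    (y : SpaceVminusW F p q) : schwartzBruhat (Matrix (Fin p) (Fin q) F) :=
  ⟨fun x => φ.1 (Matrix.fromRows x y.toCols₁) *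
      (ψ (∑ i, ∑ j, x i j * y i.rev (Sum.inr j.rev)) : ℂ), by
    have hc : Continuous fun x : Matrix (Fin p) (Fin q) F => Matrix.fromRows x y.toCols₁ :=
      (rowsHomeo p q).continuous.comp (continuous_id.prodMk continuous_const)
    have hl : Continuous fun x : Matrix (Fin p) (Fin q) F =>
        ∑ i, ∑ j, x i j * y i.rev (Sum.inr j.rev) :=
      continuous_finsetSum _ fun i _ => continuous_finsetSum _ fun j _ =>
        (continuous_id.matrix_elem i j).mul continuous_const
    refine ⟨(φ.2.1.comp_continuous hc).mul
      (((isLocallyConstant_addChar hψ hψ1).comp_continuous hl).comp fun z : Circle => (z : ℂ)), ?_⟩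
    obtain ⟨c, hc0, h⟩ := exists_subset_ball φ.2.2.isCompact
    refine HasCompactSupport.intro' (isCompact_ball c) (isClosed_ball hc0) fun x hx => ?_
    have : φ.1 (Matrix.fromRows x y.toCols₁) = 0 :=
      image_eq_zero_of_notMem_tsupport fun hmem => hx fun i j => h hmem (Sum.inl i) j
    rw [this, zero_mul]⟩

/-- The partial Fourier transform is compatible with external products, up to a nonzero constant
depending on the normalisation of measures. -/
theorem exists_mixedFourier_extProd {p q p₁ q₁ p₂ q₂ : ℕ}
    (sX : SpaceVWplus F p q ≃ₜ SpaceVWplus F p₁ q₁ × SpaceVWplus F p₂ q₂)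
    (sY : SpaceVminusW F p q ≃ₜ SpaceVminusW F p₁ q₁ × SpaceVminusW F p₂ q₂)
    (s : Matrix (Fin p) (Fin q) F ≃ₜ Matrix (Fin p₁) (Fin q₁) F × Matrix (Fin p₂) (Fin q₂) F)
    (hs : ∀ x y, s (x + y) = s x + s y)
    (hX : ∀ x y, sX (Matrix.fromRows x (Matrix.toCols₁ y)) =
      (Matrix.fromRows (s x).1 (sY y).1.toCols₁, Matrix.fromRows (s x).2 (sY y).2.toCols₁))
    (hp : ∀ x y, ∑ i, ∑ j, x i j * y i.rev (Sum.inr j.rev) =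
      (∑ i, ∑ j, (s x).1 i j * (sY y).1 i.rev (Sum.inr j.rev)) +
        ∑ i, ∑ j, (s x).2 i j * (sY y).2 i.rev (Sum.inr j.rev)) :
    ∃ C : ℂ, C ≠ 0 ∧ ∀ f g, mixedFourier hψ hψ1 p q (extProd sX f g) =
      C • extProd sY (mixedFourier hψ hψ1 p₁ q₁ f) (mixedFourier hψ hψ1 p₂ q₂ g) := by
  obtain ⟨C, hC, h⟩ := exists_haarFunctional_extProd s hs
  refine ⟨C, hC, fun f g => Subtype.ext (funext fun y => ?_)⟩
  -- For fixed y the integrand of the external product is the external product of the two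
  -- integrands: `hX` splits the argument of the function, and `hp` makes the character
  -- multiplicative.
  have e := h (mixedFourierIntegrand hψ hψ1 p₁ q₁ f (sY y).1)
    (mixedFourierIntegrand hψ hψ1 p₂ q₂ g (sY y).2)
  refine Eq.trans ?_ e
  rw [mixedFourier_apply]
  refine congrArg haarIntegral (funext fun x => ?_)
  rw [extProd_apply, extProd_apply, hX, hp, addChar_add]
  exact mul_mul_mul_comm _ _ _ _

end FourierExtProd

/-- Conjugation by `e` is insensitive to scalars, so it suffices that `e` matches the two bilinear
maps up to a nonzero constant. -/
theorem transport_bilinear {G S S₁ S₂ S' S₁' S₂' : Type*} [Group G]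
    [AddCommGroup S] [Module ℂ S] [AddCommGroup S₁] [Module ℂ S₁] [AddCommGroup S₂] [Module ℂ S₂]
    [AddCommGroup S'] [Module ℂ S'] [AddCommGroup S₁'] [Module ℂ S₁'] [AddCommGroup S₂']
    [Module ℂ S₂'] {e : S ≃ₗ[ℂ] S'} {e₁ : S₁ ≃ₗ[ℂ] S₁'} {e₂ : S₂ ≃ₗ[ℂ] S₂'}
    {β : S₁ →ₗ[ℂ] S₂ →ₗ[ℂ] S} {β' : S₁' →ₗ[ℂ] S₂' →ₗ[ℂ] S'} {C : ℂ} (hC : C ≠ 0)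
    (hβ : ∀ x y, e (β x y) = C • β' (e₁ x) (e₂ y)) {ρ : Representation ℂ G S}
    {ρ₁ : Representation ℂ G S₁} {ρ₂ : Representation ℂ G S₂}
    (hρ : ∀ g x y, ρ g (β x y) = β (ρ₁ g x) (ρ₂ g y)) (g : G) (x : S₁') (y : S₂') :
    transport e ρ g (β' x y) = β' (transport e₁ ρ₁ g x) (transport e₂ ρ₂ g y) := by
  obtain ⟨x, rfl⟩ := e₁.surjective x
  obtain ⟨y, rfl⟩ := e₂.surjective y
  refine smul_right_injective _ hC ?_
  change C • e (ρ g (e.symm _)) = C • β' (e₁ (ρ₁ g (e₁.symm _))) (e₂ (ρ₂ g (e₂.symm _)))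
  rw [e₁.symm_apply_apply, e₂.symm_apply_apply, ← hβ, ← hρ, ← map_smul, ← map_smul, ← map_smul,
    ← hβ, e.symm_apply_apply]

/-! ### Restriction of the Weil representation to the smaller dual pairs -/

section Weil
variable {F : Type*} [Field F] [ValuativeRel F] [TopologicalSpace F]
  [IsNonarchimedeanLocalField F] {a b N : ℕ} (h : a + b = N)

/-- Indices of the first half of `blockIndex`. -/
def plusIndex : Fin a ⊕ Fin b ≃ Fin N := finSumFinEquiv.trans (finCongr h)

/-- Indices of the second half of `blockIndex`. -/
def minusIndex : Fin a ⊕ Fin b ≃ Fin N :=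
  (Equiv.sumComm _ _).trans (finSumFinEquiv.trans (finCongr ((add_comm b a).trans h)))

/-- The negative basis vectors are listed in reverse order, so the outer block comes first among the
positive indices and last among the negative ones. Reversal exchanges the two orders, which is why
the Fourier pairing splits along the blocks. -/
theorem rev_plusIndex_inl (i : Fin a) :
    (plusIndex h (Sum.inl i)).rev = minusIndex h (Sum.inl i.rev) := by
  subst h
  ext
  simp [plusIndex, minusIndex]
  omega

theorem rev_plusIndex_inr (i : Fin b) :
    (plusIndex h (Sum.inr i)).rev = minusIndex h (Sum.inr i.rev) := by
  subst h
  ext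
  simp [plusIndex, minusIndex]
  omega

variable {ψ : AddChar F Circle} (hψ : Continuous ψ) (hψ1 : ψ ≠ 1)

/-- This is the case W = W₁ ⊕ W₂: columns are split and the row index is untouched. On V⁺ ⊗ W⁺ only
the positive indices occur, on V⁻ ⊗ W both kinds. -/
theorem exists_mixedFourier_splitCols (p : ℕ) :
    ∃ C : ℂ, C ≠ 0 ∧ ∀ f g,
      mixedFourier hψ hψ1 p N (extProd (splitCols _ (plusIndex h)) f g) =
        C • extProd (splitCols _ (blockIndex h)) (mixedFourier hψ hψ1 p a f)
          (mixedFourier hψ hψ1 p b g) := by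
  refine exists_mixedFourier_extProd hψ hψ1 (splitCols _ (plusIndex h))
    (splitCols _ (blockIndex h)) (splitCols _ (plusIndex h)) (fun _ _ => rfl) (fun x y => ?_)
    (fun x y => ?_)
  · refine Prod.ext ?_ ?_ <;> refine Matrix.ext fun i j => ?_ <;> rcases i with i | i <;> rfl
  · rw [← Finset.sum_add_distrib]
    refine Finset.sum_congr rfl fun i _ => ?_
    rw [← (plusIndex h).sum_comp, Fintype.sum_sum_type]
    simp only [rev_plusIndex_inl, rev_plusIndex_inr]
    rfl

/-- This is the case V = V₁ ⊕ V₂. The rows of V⁻ ⊗ W belong to the negative basis vectors of V, so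
they are split by `minusIndex`. -/
theorem exists_mixedFourier_splitRows (q : ℕ) :
    ∃ C : ℂ, C ≠ 0 ∧ ∀ f g,
      mixedFourier hψ hψ1 N q (extProd (splitRows _ (blockIndex h)) f g) =
        C • extProd (splitRows _ (minusIndex h)) (mixedFourier hψ hψ1 a q f)
          (mixedFourier hψ hψ1 b q g) := by
  refine exists_mixedFourier_extProd hψ hψ1 (splitRows _ (blockIndex h))
    (splitRows _ (minusIndex h)) (splitRows _ (plusIndex h)) (fun _ _ => rfl) (fun x y => ?_)
    (fun x y => ?_)
  · refine Prod.ext ?_ ?_ <;> refine Matrix.ext fun i j => ?_ <;> rcases i with i | i <;> rfl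
  · rw [← (plusIndex h).sum_comp, Fintype.sum_sum_type]
    simp only [rev_plusIndex_inl, rev_plusIndex_inr]
    rfl

/-- Left multiplication commutes with selecting columns, so SO(V) acts on both factors at once. -/
theorem linearSO_splitCols (p : ℕ) (g : SO F p) (φ₁ φ₂) :
    linearSO p N g (extProd (splitCols _ (plusIndex h)) φ₁ φ₂) =
      extProd (splitCols _ (plusIndex h)) (linearSO p a g φ₁) (linearSO p b g φ₂) := rfl

theorem linearSp_splitCols (p : ℕ) (g₁ : Sp F a) (g₂ : Sp F b) (φ₁ φ₂) :
    linearSp p N (spBlock h g₁ g₂) (extProd (splitCols _ (blockIndex h)) φ₁ φ₂) =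
      extProd (splitCols _ (blockIndex h)) (linearSp p a g₁ φ₁) (linearSp p b g₂ φ₂) := by
  refine Subtype.ext (funext fun y => ?_)
  change φ₁.1 (splitCols _ (blockIndex h) (y * blockMatrix h g₁.1.1 g₂.1.1)).1 *
    φ₂.1 (splitCols _ (blockIndex h) (y * blockMatrix h g₁.1.1 g₂.1.1)).2 = _
  rw [blockMatrix, splitCols_mul_blockDiagonal]
  rfl

theorem linearSp_splitRows (q : ℕ) (g : Sp F q) (φ₁ φ₂) :
    linearSp N q g (extProd (splitRows _ (minusIndex h)) φ₁ φ₂) =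
      extProd (splitRows _ (minusIndex h)) (linearSp a q g φ₁) (linearSp b q g φ₂) := rfl

theorem linearSO_splitRows (q : ℕ) (g₁ : SO F a) (g₂ : SO F b) (φ₁ φ₂) :
    linearSO N q (soBlock h g₁ g₂) (extProd (splitRows _ (blockIndex h)) φ₁ φ₂) =
      extProd (splitRows _ (blockIndex h)) (linearSO a q g₁ φ₁) (linearSO b q g₂ φ₂) := by
  refine Subtype.ext (funext fun x => ?_)
  -- The action is through inverses, and `blockGL` has the block matrix of the inverses as its
  -- inverse by definition.
  change φ₁.1 (splitRows _ (blockIndex h) (blockMatrix h g₁⁻¹.1.1 g₂⁻¹.1.1 * x)).1 *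
    φ₂.1 (splitRows _ (blockIndex h) (blockMatrix h g₁⁻¹.1.1 g₂⁻¹.1.1 * x)).2 = _
  rw [blockMatrix, splitRows_blockDiagonal_mul]
  rfl

theorem weilVminusWSO_extProd (p : ℕ) (g : SO F p) (φ₁ φ₂) :
    weilVminusWSO hψ hψ1 p N g (extProd (splitCols _ (blockIndex h)) φ₁ φ₂) =
      extProd (splitCols _ (blockIndex h)) (weilVminusWSO hψ hψ1 p a g φ₁)
        (weilVminusWSO hψ hψ1 p b g φ₂) := by
  obtain ⟨C, hC, hM⟩ := exists_mixedFourier_splitCols h hψ hψ1 p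
  exact transport_bilinear hC hM (linearSO_splitCols h p) g φ₁ φ₂

theorem weilVWplusSp_extProd (q : ℕ) (g : Sp F q) (φ₁ φ₂) :
    weilVWplusSp hψ hψ1 N q g (extProd (splitRows _ (blockIndex h)) φ₁ φ₂) =
      extProd (splitRows _ (blockIndex h)) (weilVWplusSp hψ hψ1 a q g φ₁)
        (weilVWplusSp hψ hψ1 b q g φ₂) := by
  obtain ⟨C, hC, hM⟩ := exists_mixedFourier_splitRows h hψ hψ1 q
  -- Here the conjugation is by the inverse Fourier transform, so the constant is inverted.
  refine transport_bilinear (inv_ne_zero hC) (fun x y => ?_) (linearSp_splitRows h q) g φ₁ φ₂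
  rw [LinearEquiv.symm_apply_eq, map_smul, hM, LinearEquiv.apply_symm_apply,
    LinearEquiv.apply_symm_apply, smul_smul, inv_mul_cancel₀ hC, one_smul]

end Weil
end
end LocalTheta

/-! ### The two see-saws -/

theorem theorem5p1 {F : Type*} [Field F] [ValuativeRel F] [TopologicalSpace F]
    [IsNonarchimedeanLocalField F] [CharZero F]
    (ψ : AddChar F Circle) (hψ : Continuous ψ) (hψ1 : ψ ≠ 1)
    (m n : ℕ) (hmn : n ≤ 2 * m) :
    -- Part (1)
    (∀ (Vπ Vσ : Type*) [AddCommGroup Vπ] [Module ℂ Vπ] [AddCommGroup Vσ] [Module ℂ Vσ]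
      (π : Representation ℂ (LocalTheta.Sp F (2 * m)) Vπ)
      (σ : Representation ℂ (LocalTheta.SO F (2 * n)) Vσ),
      LocalTheta.IsIrreducibleAdmissible π →
      LocalTheta.IsIrreducibleAdmissible σ →
      LocalTheta.HasSymplecticLinearModel (a := n) (b := 2 * m - n) (Nat.add_sub_cancel' hmn) π →
      LocalTheta.Corresponds (LocalTheta.weilVminusWSO hψ hψ1 (2 * n) (2 * m))
        (LocalTheta.weilVminusWSp (2 * n) (2 * m)) σ π →
      ∃ T : ((LocalTheta.thetaTrivialSp hψ hψ1 (2 * n) n).tprod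
          (LocalTheta.thetaTrivialSp hψ hψ1 (2 * n) (2 * m - n))).IntertwiningMap σ, T ≠ 0) ∧
    -- Part (2)
    (∀ (Vπ Vσ : Type*) [AddCommGroup Vπ] [Module ℂ Vπ] [AddCommGroup Vσ] [Module ℂ Vσ]
      (π : Representation ℂ (LocalTheta.Sp F (2 * n)) Vπ)
      (σ : Representation ℂ (LocalTheta.SO F (2 * m)) Vσ),
      LocalTheta.IsIrreducibleAdmissible π →
      LocalTheta.IsIrreducibleAdmissible σ →
      LocalTheta.HasOrthogonalLinearModel (a := n) (b := 2 * m - n) (Nat.add_sub_cancel' hmn) σ →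
      LocalTheta.Corresponds (LocalTheta.weilVWplusSO (2 * m) (2 * n))
        (LocalTheta.weilVWplusSp hψ hψ1 (2 * m) (2 * n)) σ π →
      ∃ T : ((LocalTheta.thetaTrivialSO hψ hψ1 n (2 * n)).tprod
          (LocalTheta.thetaTrivialSO hψ hψ1 (2 * m - n) (2 * n))).IntertwiningMap π, T ≠ 0) := by
  constructor
  · rintro Vπ Vσ _ _ _ _ π σ hπ - ⟨l, hl, hli⟩ hT
    -- Here G = SO(V), and W = W₁ ⊕ W₂ splits the columns of V⁻ ⊗ W.
    exact LocalTheta.exists_intertwiningMap_bigTheta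
      (LocalTheta.extProd (LocalTheta.splitCols _
        (LocalTheta.blockIndex (Nat.add_sub_cancel' hmn))))
      (LocalTheta.span_extProd _) (LocalTheta.spBlock (Nat.add_sub_cancel' hmn))
      (LocalTheta.weilVminusWSO_extProd _ hψ hψ1 _) (LocalTheta.linearSp_splitCols _ _)
      hπ.irreducible hl hli hT
  · rintro Vπ Vσ _ _ _ _ π σ - hσ ⟨l, hl, hli⟩ hT
    -- Here G = Sp(W), and V = V₁ ⊕ V₂ splits the rows of V ⊗ W⁺. The contraction is now on σ, hence
    -- `hT.symm`.
    exact LocalTheta.exists_intertwiningMap_bigTheta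
      (LocalTheta.extProd (LocalTheta.splitRows _
        (LocalTheta.blockIndex (Nat.add_sub_cancel' hmn))))
      (LocalTheta.span_extProd _) (LocalTheta.soBlock (Nat.add_sub_cancel' hmn))
      (LocalTheta.weilVWplusSp_extProd _ hψ hψ1 _) (LocalTheta.linearSO_splitRows _ _)
      hσ.irreducible hl hli hT.symm
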